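/- Let $u\in C^2(\mathbb R)$ be a real-valued potential in the Faddeev class $P_1$, i.e. $\int_{\mathbb R}(1+|x|)\,|u(x)|\,dx<\infty$. For $k\in\mathbb C\setminus\{0\}$ with $\operatorname{Im}k\ge 0$ let $\varphi_k$ and $\psi_k$ be the solutions of $$v''+(u(x)+k^2)\,v=0\qquad(x\in\mathbb R)$$ with $\varphi_k(x)\sim e^{-ikx}$ as $x\to-\infty$ and $\psi_k(x)\sim e^{ikx}$ as $x\to+\infty$ (with the corresponding asymptotics of the first derivatives), and let $$B(k)=\frac{W(\varphi_k,\psi_k)}{2ik},\qquad W(f,g)=f\,g'-g\,f',$$ the Wronskian being independent of $x$. (For real $k\neq0$, $B(k)$ is the coefficient in $\varphi_k=A(k)\psi_k+B(k)\psi_{-k}$.) Then $B$ has only finitely many zeros in $\{k\ne 0:\operatorname{Im}k\ge0\}$; all of them lie on the positive imaginary axis $\{i\sigma:\sigma>0\}$, and all of them are simple, i.e. zeros of order exactly one of the function $B$, which is analytic near them. -/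

import Mathlib

open Filter Topology

noncomputable section

/-- The Faddeev class `P₁`: real potentials `u ∈ C²(ℝ)` with `∫ (1 + |x|) |u(x)| dx < ∞`. -/
structure FaddeevClass (u : ℝ → ℝ) : Prop where
  contDiff : ContDiff ℝ 2 u
  integrable : MeasureTheory.Integrable (fun x : ℝ => (1 + |x|) * |u x|)

/-- `f` is a classical complex solution of `f'' + (u + k²) f = 0` on the whole line. -/
structure IsSchrodingerSolution (u : ℝ → ℝ) (k : ℂ) (f : ℝ → ℂ) : Prop where
  contDiff : ContDiff ℝ 2 f
  eqn : ∀ x : ℝ, deriv (deriv f) x + ((u x : ℂ) + k ^ 2) * f x = 0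

/-- `f` is the Jost solution normalised at the left end: `f(x) ~ e^{-ikx}` as `x → -∞`, the
asymptotics being meant, as usual, together with that of the first derivative. -/
structure IsLeftJost (u : ℝ → ℝ) (k : ℂ) (f : ℝ → ℂ) : Prop where
  solution : IsSchrodingerSolution u k f
  tendsto : Tendsto (fun x : ℝ => f x * Complex.exp (Complex.I * k * x)) atBot (𝓝 1)
  tendsto_deriv : Tendsto (fun x : ℝ => deriv f x * Complex.exp (Complex.I * k * x)) atBot
    (𝓝 (-(Complex.I * k)))

/-- `f` is the Jost solution normalised at the right end: `f(x) ~ e^{ikx}` as `x → +∞`, the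
asymptotics being meant, as usual, together with that of the first derivative. -/
structure IsRightJost (u : ℝ → ℝ) (k : ℂ) (f : ℝ → ℂ) : Prop where
  solution : IsSchrodingerSolution u k f
  tendsto : Tendsto (fun x : ℝ => f x * Complex.exp (-(Complex.I * k * x))) atTop (𝓝 1)
  tendsto_deriv : Tendsto (fun x : ℝ => deriv f x * Complex.exp (-(Complex.I * k * x))) atTop
    (𝓝 (Complex.I * k))

/-- The eigenfunction `φ_k`, the left Jost solution (for `Im k ≥ 0`, `k ≠ 0` and `u` in the
Faddeev class there is exactly one; otherwise the value is unspecified). -/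
def jostPhi (u : ℝ → ℝ) (k : ℂ) : ℝ → ℂ := Classical.epsilon (IsLeftJost u k)

/-- The eigenfunction `ψ_k`, the right Jost solution (same proviso as for `jostPhi`). -/
def jostPsi (u : ℝ → ℝ) (k : ℂ) : ℝ → ℂ := Classical.epsilon (IsRightJost u k)

/-- The Wronskian `W(f, g) = f g' - g f'`. -/
def wronskianFn (f g : ℝ → ℂ) (x : ℝ) : ℂ := f x * deriv g x - g x * deriv f x

/-- The scattering coefficient `B(k) = W(φ_k, ψ_k) / (2ik)`. The Wronskian does not depend on the
point (`wronskianFn_eq`), so it is evaluated at `0`. For real `k` this is the coefficient `B(k)` in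
`φ_k = A(k) ψ_k + B(k) ψ_{-k}` (`coefficient_eq`). -/
def scatteringB (u : ℝ → ℝ) (k : ℂ) : ℂ :=
  wronskianFn (jostPhi u k) (jostPsi u k) 0 / (2 * Complex.I * k)

/-- The Wronskian of two solutions of the same Schrödinger equation is constant. -/
theorem wronskianFn_eq {u : ℝ → ℝ} {k : ℂ} {f g : ℝ → ℂ} (hf : IsSchrodingerSolution u k f)
    (hg : IsSchrodingerSolution u k g) (x y : ℝ) : wronskianFn f g x = wronskianFn f g y := by
  have key : ∀ {f : ℝ → ℂ}, ContDiff ℝ 2 f → ∀ x, HasDerivAt f (deriv f x) x ∧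
      HasDerivAt (deriv f) (deriv (deriv f) x) x := by
    intro f hf x
    have h2 : ContDiff ℝ (1 + 1) f := by simpa [one_add_one_eq_two] using hf
    have h1 : ContDiff ℝ 1 (deriv f) := (contDiff_succ_iff_deriv.1 h2).2.2
    exact ⟨(hf.differentiable (by norm_num) x).hasDerivAt,
      (h1.differentiable (by norm_num) x).hasDerivAt⟩
  have hd : ∀ x, HasDerivAt (wronskianFn f g) 0 x := by
    intro x
    obtain ⟨f1, f2⟩ := key hf.contDiff x
    obtain ⟨g1, g2⟩ := key hg.contDiff x
    have h := (f1.mul g2).sub (g1.mul f2)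
    refine h.congr_deriv ?_
    linear_combination f x * hg.eqn x - g x * hf.eqn x
  exact is_const_of_deriv_eq_zero (fun x => (hd x).differentiableAt) (fun x => (hd x).deriv) x y

/-- The coefficient of `ψ_{-k}` in `φ_k = a ψ_k + b ψ_{-k}` is `W(φ_k, ψ_k) / (2ik)`. -/
theorem coefficient_eq {u : ℝ → ℝ} {k : ℂ} (hk : k ≠ 0) {f g : ℝ → ℂ} {a b : ℂ}
    (hf : IsRightJost u k f) (hg : IsRightJost u (-k) g) :
    wronskianFn (fun x => a * f x + b * g x) f 0 / (2 * Complex.I * k) = b := by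
  have hg' : IsSchrodingerSolution u k g :=
    ⟨hg.solution.contDiff, fun x => by simpa using hg.solution.eqn x⟩
  have hW : wronskianFn g f 0 = 2 * Complex.I * k := by
    have h := (hg.tendsto.mul hf.tendsto_deriv).sub (hf.tendsto.mul hg.tendsto_deriv)
    have hc : (fun x : ℝ => g x * Complex.exp (-(Complex.I * -k * x)) *
        (deriv f x * Complex.exp (-(Complex.I * k * x))) -
        f x * Complex.exp (-(Complex.I * k * x)) *
        (deriv g x * Complex.exp (-(Complex.I * -k * x)))) = fun _ => wronskianFn g f 0 := by
      funext x
      have he : Complex.exp (-(Complex.I * -k * x)) * Complex.exp (-(Complex.I * k * x)) = 1 := by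
        rw [← Complex.exp_add]; simp
      rw [wronskianFn_eq hg' hf.solution 0 x, wronskianFn]
      linear_combination (g x * deriv f x - f x * deriv g x) * he
    rw [hc] at h
    rw [tendsto_nhds_unique tendsto_const_nhds h]
    ring
  have hlin : wronskianFn (fun x => a * f x + b * g x) f 0 = b * wronskianFn g f 0 := by
    have f1 := (hf.solution.contDiff.differentiable (by norm_num) 0).hasDerivAt
    have g1 := (hg.solution.contDiff.differentiable (by norm_num) 0).hasDerivAt
    have h := ((f1.const_mul a).add (g1.const_mul b)).deriv
    have h' : deriv (fun x => a * f x + b * g x) 0 = a * deriv f 0 + b * deriv g 0 := h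
    simp only [wronskianFn, h']
    ring
  rw [hlin, hW]
  have := Complex.I_ne_zero
  field_simp

end

/-! Write `ψ_k = e^{ikx} m`. The factor `m` solves a Volterra equation `(1 - T_k) m = 1` in the
bounded continuous functions, and the powers of `T_k` are bounded by `C^n / n!`, so `1 - T_k` is
invertible (`isUnit_one_sub_convolveL`). For `Im k > 0` the kernel is differentiable in `k` in the
sup norm, hence so are `m` and the Cauchy data of `ψ_k` at `0`. Reflection `x ↦ -x` turns `φ_k` into
a right Jost solution.

At a zero of `B` the Wronskian vanishes, so `φ_k = c ψ_k` with `c ≠ 0`. For real `k` the conserved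
flux `W(ψ̄, ψ) = 2ik`, compared from both ends, would give `-|c|² = 1`. For `Im k > 0` the function
`ψ_k` decays exponentially at both ends, so it is an eigenfunction of the symmetric operator
`-d²/dx² - u` with eigenvalue `k²`. Thus `k²` is real and `k` is purely imaginary
(`re_eq_zero_of_zero`).

Simplicity: letting `l → k` in `W(ψ_k, ψ_l)(0) = (l² - k²) ∫_0^∞ ψ_k ψ_l`, and adding the reflected
identity, shows that the Wronskian in `B` has derivative `2kc ∫ ψ_k²` at a zero. This is nonzero
because `ψ_k` is real on the imaginary axis (`analyticOrderAt_scatteringB`).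

Finiteness: eigenfunctions of distinct negative energies are orthogonal, so every nontrivial
combination `G` satisfies `∫ G'² < ∫ |u| G²`. The finite first moment of `u` yields finitely many
points such that vanishing there forces the opposite inequality
(`exists_points_quadraticForm_nonneg`). With more eigenfunctions than points, linear algebra
produces a nontrivial combination vanishing at all of them. -/

namespace Schrodinger

open MeasureTheory Set BoundedContinuousFunction

noncomputable section

/-! ### Volterra operators on bounded continuous functions -/

section Volterra

/-- The tail `∫_x^∞ |u|`. -/
def tail (u : ℝ → ℝ) (x : ℝ) : ℝ := ∫ t in Ioi x, |u t|

/-- For continuous `f`, the integral over `(x, ∞)` has derivative `-f x`. -/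
theorem hasDerivAt_integral_Ioi {F : Type*} [NormedAddCommGroup F] [NormedSpace ℝ F]
    [CompleteSpace F] {f : ℝ → F} (hc : Continuous f) (hi : ∀ x, IntegrableOn f (Ioi x)) (x : ℝ) :
    HasDerivAt (fun y => ∫ t in Ioi y, f t) (-f x) x := by
  have h : (fun y => ∫ t in Ioi y, f t) = fun y => (∫ t in Ioi 0, f t) - ∫ t in (0 : ℝ)..y, f t := by
    funext y
    rw [intervalIntegral.integral_Ioi_sub_Ioi' (hi 0) (hi y) |>.symm]
    abel
  rw [h]
  simpa using (hc.integral_hasStrictDerivAt 0 x).hasDerivAt.const_sub (∫ t in Ioi 0, f t)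

variable {u : ℝ → ℝ}

theorem tail_nonneg (u : ℝ → ℝ) (x : ℝ) : 0 ≤ tail u x :=
  integral_nonneg fun _ => abs_nonneg _

theorem tail_le (hi : Integrable u) (x : ℝ) : tail u x ≤ ∫ t, |u t| :=
  setIntegral_le_integral hi.abs (ae_of_all _ fun _ => abs_nonneg _)

theorem hasDerivAt_tail (hc : Continuous u) (hi : Integrable u) (x : ℝ) : HasDerivAt (tail u)
    (-|u x|) x :=
  hasDerivAt_integral_Ioi hc.abs (fun _ => hi.abs.integrableOn) x

theorem tendsto_tail (u : ℝ → ℝ) : Tendsto (tail u) atTop (𝓝 0) :=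
  tendsto_integral_Ioi_zero tendsto_id

/-- The integrand is the derivative of `-tail^(n+1) / (n+1)`. The factor `1 / (n+1)` is what
accumulates to `1 / n!` in the iterates of the Volterra operator. -/
theorem integral_tail_pow (hc : Continuous u) (hi : Integrable u) (n : ℕ) (x : ℝ) :
    IntegrableOn (fun t => |u t| * tail u t ^ n) (Ioi x) ∧
      ∫ t in Ioi x, |u t| * tail u t ^ n = tail u x ^ (n + 1) / (n + 1) := by
  have hcont : Continuous (tail u) :=
    continuous_iff_continuousAt.2 fun x => (hasDerivAt_tail hc hi x).continuousAt
  have hint : IntegrableOn (fun t => |u t| * tail u t ^ n) (Ioi x) := by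
    refine (hi.abs.mul_bdd (c := (∫ t, |u t|) ^ n)
      (hcont.pow n).aestronglyMeasurable (ae_of_all _ fun t => ?_)).integrableOn
    rw [Pi.pow_apply, norm_pow, Real.norm_of_nonneg (tail_nonneg u t)]
    exact pow_le_pow_left₀ (tail_nonneg u t) (tail_le hi t) n
  refine ⟨hint, ?_⟩
  have h := integral_Ioi_of_hasDerivAt_of_tendsto (a := x) (m := 0)
    (f := fun t => -(tail u t ^ (n + 1) / (n + 1))) (f' := fun t => |u t| * tail u t ^ n)
    (by fun_prop) (fun t _ => ?_) hint ?_
  · rw [h]; ring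
  · have h1 := (((hasDerivAt_tail hc hi t).pow (n + 1)).div_const ((n : ℝ) + 1)).neg
    refine h1.congr_deriv ?_
    have : (n : ℝ) + 1 ≠ 0 := by positivity
    push_cast
    field_simp
  · have h1 := (((tendsto_tail u).pow (n + 1)).div_const ((n : ℝ) + 1)).neg
    simpa using h1

theorem integrable_kernel (hi : Integrable u) (g m : ℝ →ᵇ ℂ) (x : ℝ) :
    Integrable fun t => g (t - x) * ((u t : ℂ) * m t) := by
  refine Integrable.bdd_mul (c := ‖g‖) ?_ ?_ (ae_of_all _ fun t => g.norm_coe_le_norm _)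
  · exact hi.ofReal.mul_bdd (c := ‖m‖) m.continuous.aestronglyMeasurable
      (ae_of_all _ fun t => m.norm_coe_le_norm _)
  · exact (g.continuous.comp (by fun_prop : Continuous fun t : ℝ => t - x)).aestronglyMeasurable

theorem norm_kernel_le (g m : ℝ →ᵇ ℂ) (s t : ℝ) :
    ‖g s * ((u t : ℂ) * m t)‖ ≤ ‖g‖ * ‖m‖ * |u t| := by
  rw [norm_mul, norm_mul, Complex.norm_real, Real.norm_eq_abs]
  calc _ ≤ ‖g‖ * (|u t| * ‖m‖) := by gcongr <;> exact norm_coe_le_norm _ _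
    _ = _ := by ring

/-- The function `x ↦ ∫ g(t - x) u(t) m(t) dt`. -/
def convolve (hi : Integrable u) (g m : ℝ →ᵇ ℂ) : ℝ →ᵇ ℂ :=
  ofNormedAddCommGroup (fun x => ∫ t, g (t - x) * ((u t : ℂ) * m t))
    (continuous_of_dominated (bound := fun t => ‖g‖ * ‖m‖ * |u t|)
      (fun x => (integrable_kernel hi g m x).aestronglyMeasurable)
      (fun x => ae_of_all _ fun t => norm_kernel_le g m _ t) (hi.abs.const_mul _)
      (ae_of_all _ fun t => (g.continuous.comp
        (by fun_prop : Continuous fun x : ℝ => t - x)).mul continuous_const))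
    (‖g‖ * ‖m‖ * ∫ t, |u t|)
    (fun x => by
      rw [← integral_const_mul]
      exact norm_integral_le_of_norm_le (hi.abs.const_mul _)
        (ae_of_all _ fun t => norm_kernel_le g m _ t))

theorem convolve_apply (hi : Integrable u) (g m : ℝ →ᵇ ℂ) (x : ℝ) :
    convolve hi g m x = ∫ t, g (t - x) * ((u t : ℂ) * m t) := rfl

/-- `convolve` as a bounded bilinear map. -/
def convolveL (hi : Integrable u) : (ℝ →ᵇ ℂ) →L[ℂ] (ℝ →ᵇ ℂ) →L[ℂ] (ℝ →ᵇ ℂ) :=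
  LinearMap.mkContinuous₂ (LinearMap.mk₂ ℂ (convolve hi)
    (fun g₁ g₂ m => by
      ext x
      simp only [convolve_apply, BoundedContinuousFunction.add_apply]
      rw [← integral_add (integrable_kernel hi _ _ _) (integrable_kernel hi _ _ _)]
      simp only [add_mul])
    (fun c g m => by
      ext x
      simp only [convolve_apply, BoundedContinuousFunction.smul_apply, smul_eq_mul]
      rw [← integral_const_mul]
      simp only [mul_assoc])
    (fun g m₁ m₂ => by
      ext x
      simp only [convolve_apply, BoundedContinuousFunction.add_apply]
      rw [← integral_add (integrable_kernel hi _ _ _) (integrable_kernel hi _ _ _)]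
      simp only [mul_add])
    (fun c g m => by
      ext x
      simp only [convolve_apply, BoundedContinuousFunction.smul_apply, smul_eq_mul]
      rw [← integral_const_mul]
      exact integral_congr_ae (ae_of_all _ fun t => by ring)))
    (∫ t, |u t|) (fun g m => by
      have h : ‖convolve hi g m‖ ≤ ‖g‖ * ‖m‖ * ∫ t, |u t| :=
        norm_ofNormedAddCommGroup_le _ (mul_nonneg (mul_nonneg (norm_nonneg g) (norm_nonneg m))
          (integral_nonneg fun _ => abs_nonneg _)) _
      exact h.trans_eq (by ring))

theorem convolveL_apply (hi : Integrable u) (g m : ℝ →ᵇ ℂ) (x : ℝ) :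
    convolveL hi g m x = ∫ t, g (t - x) * ((u t : ℂ) * m t) := rfl

theorem convolveL_apply_Ioi (hi : Integrable u) {g : ℝ →ᵇ ℂ} (hg : ∀ y ≤ 0, g y = 0) (m : ℝ →ᵇ ℂ)
    (x : ℝ) :
    convolveL hi g m x = ∫ t in Ioi x, g (t - x) * ((u t : ℂ) * m t) := by
  rw [convolveL_apply, ← integral_indicator measurableSet_Ioi]
  refine integral_congr_ae (ae_of_all _ fun t => ?_)
  by_cases h : t ∈ Ioi x
  · simp [indicator_of_mem h]
  · rw [indicator_of_notMem h]
    simp [hg (t - x) (by simpa using h)]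

/-- By induction: a kernel vanishing on `y ≤ 0` integrates only over `t > x`, so each further
application integrates the previous bound against `|u|` on a half-line. -/
theorem norm_convolveL_pow_apply_le (hc : Continuous u) (hi : Integrable u) {g : ℝ →ᵇ ℂ}
    (hg : ∀ y ≤ 0, g y = 0) (m : ℝ →ᵇ ℂ) (n : ℕ) :
    ∀ x, ‖((convolveL hi g) ^ n) m x‖ ≤ ‖g‖ ^ n * ‖m‖ * tail u x ^ n / n.factorial := by
  induction n with
  | zero => intro x; simpa using m.norm_coe_le_norm x
  | succ n ih =>
    intro x
    rw [pow_succ', mul_apply_eq_comp, convolveL_apply_Ioi hi hg]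
    obtain ⟨h1, h2⟩ := integral_tail_pow hc hi n x
    refine (norm_integral_le_of_norm_le (h1.const_mul (‖g‖ ^ (n + 1) * ‖m‖ / n.factorial))
      (ae_of_all _ fun t => ?_)).trans_eq ?_
    · rw [norm_mul, norm_mul, Complex.norm_real, Real.norm_eq_abs]
      calc _ ≤ ‖g‖ * (|u t| * (‖g‖ ^ n * ‖m‖ * tail u t ^ n / n.factorial)) := by
            gcongr
            · exact norm_coe_le_norm _ _
            · exact ih t
        _ = _ := by ring
    · rw [integral_const_mul, h2, Nat.factorial_succ]
      push_cast
      field_simp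

/-- The operator `T` need not be small, but some power has norm below `1`. Then `1 - T^n` is a unit,
and `1 - T` is one of its two commuting factors, the other being a geometric sum. -/
theorem isUnit_one_sub_convolveL (hc : Continuous u) (hi : Integrable u) {g : ℝ →ᵇ ℂ}
    (hg : ∀ y ≤ 0, g y = 0) :
    IsUnit (1 - convolveL hi g) := by
  set T := convolveL hi g
  obtain ⟨n, hn⟩ : ∃ n : ℕ, (‖g‖ * ∫ t, |u t|) ^ n / n.factorial < 1 :=
    ((FloorSemiring.tendsto_pow_div_factorial_atTop
      (‖g‖ * ∫ t, |u t|)).eventually_lt_const one_pos).exists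
  have hT : ‖T ^ n‖ < 1 := by
    refine lt_of_le_of_lt (ContinuousLinearMap.opNorm_le_bound _ (by positivity) fun m => ?_) hn
    refine (BoundedContinuousFunction.norm_le (by positivity)).2 fun x => ?_
    refine (norm_convolveL_pow_apply_le hc hi hg m n x).trans ?_
    rw [mul_pow]
    have := pow_le_pow_left₀ (tail_nonneg u x) (tail_le hi x) n
    calc _ ≤ ‖g‖ ^ n * ‖m‖ * (∫ t, |u t|) ^ n / n.factorial := by gcongr
      _ = _ := by ring
  have h1 : IsUnit (1 - T ^ n) :=
    isUnit_one_sub_of_norm_lt_one (R := (ℝ →ᵇ ℂ) →L[ℂ] (ℝ →ᵇ ℂ)) hT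
  rw [← mul_neg_geom_sum] at h1
  refine ((Commute.isUnit_mul_iff ?_).1 h1).1
  rw [commute_iff_eq, mul_neg_geom_sum, geom_sum_mul_neg]

end Volterra

/-! ### Construction of the Jost solution -/

section JostSolution

variable {u : ℝ → ℝ} {k : ℂ}

theorem isSchrodingerSolution_of_hasDerivAt {f f' : ℝ → ℂ} (hu : Continuous u)
    (h1 : ∀ x, HasDerivAt f (f' x) x)
    (h2 : ∀ x, HasDerivAt f' (-((u x : ℂ) + k ^ 2) * f x) x) :
    IsSchrodingerSolution u k f ∧ deriv f = f' := by
  have e1 : deriv f = f' := funext fun x => (h1 x).deriv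
  have e2 : deriv f' = fun x => -((u x : ℂ) + k ^ 2) * f x := funext fun x => (h2 x).deriv
  have hf : Continuous f := continuous_iff_continuousAt.2 fun x => (h1 x).continuousAt
  refine ⟨⟨?_, fun x => ?_⟩, e1⟩
  · rw [← one_add_one_eq_two, contDiff_succ_iff_deriv]
    refine ⟨fun x => (h1 x).differentiableAt, by simp, ?_⟩
    rw [e1, contDiff_one_iff_deriv, e2]
    exact ⟨fun x => (h2 x).differentiableAt, by fun_prop⟩
  · rw [e1, e2]; ring

theorem norm_exp_two_I_mul_le (hk : 0 ≤ k.im) {y : ℝ} (hy : 0 ≤ y) :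
    ‖Complex.exp (2 * Complex.I * k * y)‖ ≤ 1 := by
  rw [Complex.norm_exp, Real.exp_le_one_iff]
  have : (2 * Complex.I * k * y).re = -(2 * k.im * y) := by simp
  rw [this]
  nlinarith [mul_nonneg hk hy]

open Classical in
/-- The function `y ↦ e^{2iky⁺}`, bounded when `Im k ≥ 0`. -/
def expKernel (k : ℂ) : ℝ →ᵇ ℂ :=
  if h : 0 ≤ k.im then
    ofNormedAddCommGroup (fun y : ℝ => Complex.exp (2 * Complex.I * k * (max y 0 : ℝ)))
      (by fun_prop) 1 (fun y => norm_exp_two_I_mul_le h (le_max_right y 0))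
  else 0

theorem expKernel_apply (hk : 0 ≤ k.im) (y : ℝ) :
    expKernel k y = Complex.exp (2 * Complex.I * k * (max y 0 : ℝ)) := by
  simp [expKernel, hk]

/-- The kernel `y ↦ -(e^{2iky⁺} - 1) / (2ik)` of the integral equation for the Jost solution. -/
def jostKernel (k : ℂ) : ℝ →ᵇ ℂ := (-(2 * Complex.I * k)⁻¹) • (expKernel k - 1)

theorem jostKernel_apply (hk : 0 ≤ k.im) (y : ℝ) : jostKernel k y =
    -(2 * Complex.I * k)⁻¹ * (Complex.exp (2 * Complex.I * k * (max y 0 : ℝ)) - 1) := by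
  rw [← expKernel_apply hk]; rfl

theorem jostKernel_of_nonpos (hk : 0 ≤ k.im) (y : ℝ) (hy : y ≤ 0) : jostKernel k y = 0 := by
  rw [jostKernel_apply hk, max_eq_right hy]; simp

/-- The solution `m` of `m(x) = 1 - ∫_x^∞ (e^{2ik(t-x)} - 1) / (2ik) u(t) m(t) dt`. -/
def jostM (hi : Integrable u) (k : ℂ) : ℝ →ᵇ ℂ :=
  Ring.inverse (1 - convolveL hi (jostKernel k)) 1

theorem jostM_eq (hc : Continuous u) (hi : Integrable u) (hk : 0 ≤ k.im) :
    jostM hi k = 1 + convolveL hi (jostKernel k) (jostM hi k) := by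
  have h := Ring.mul_inverse_cancel _ (isUnit_one_sub_convolveL hc hi (jostKernel_of_nonpos hk))
  have h1 := congrArg (fun T : (ℝ →ᵇ ℂ) →L[ℂ] (ℝ →ᵇ ℂ) => T 1) h
  simp only [mul_apply_eq_comp, _root_.sub_apply, one_apply_eq_self] at h1
  rw [← sub_eq_iff_eq_add]
  exact h1

theorem integrable_mul_bcf (hi : Integrable u) (m : ℝ →ᵇ ℂ) :
    Integrable fun t => (u t : ℂ) * m t :=
  hi.ofReal.mul_bdd (c := ‖m‖) m.continuous.aestronglyMeasurable
    (ae_of_all _ fun _ => m.norm_coe_le_norm _)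

theorem integrableOn_exp_mul (hi : Integrable u) (hk : 0 ≤ k.im) (m : ℝ →ᵇ ℂ) (x : ℝ) :
    IntegrableOn (fun t : ℝ => Complex.exp (2 * Complex.I * k * t) * ((u t : ℂ) * m t))
      (Ioi x) := by
  refine Integrable.bdd_mul (c := Real.exp (-(2 * k.im * x))) (integrable_mul_bcf hi m).integrableOn
    (by fun_prop) ?_
  refine (ae_restrict_iff' measurableSet_Ioi).2 (ae_of_all _ fun t ht => ?_)
  rw [Complex.norm_exp, Real.exp_le_exp]
  have : (2 * Complex.I * k * t).re = -(2 * k.im * t) := by simp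
  rw [this]
  nlinarith [mul_nonneg hk (sub_nonneg.2 (mem_Ioi.1 ht).le)]

/-- The derivative of `jostM`, namely `∫_x^∞ e^{2ik(t-x)} u(t) m(t) dt`. -/
def jostM' (hi : Integrable u) (k : ℂ) (x : ℝ) : ℂ :=
  Complex.exp (-(2 * Complex.I * k * x)) *
    ∫ t in Ioi x, Complex.exp (2 * Complex.I * k * t) * ((u t : ℂ) * jostM hi k t)

/-- Splitting the kernel and using `e^{2ik(t-x)} = e^{-2ikx} e^{2ikt}` leaves `x` only in a
prefactor and in the limit of integration, so the formula can be differentiated directly in `x`. -/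
theorem jostM_apply (hc : Continuous u) (hi : Integrable u) (hk : 0 ≤ k.im) (x : ℝ) :
    jostM hi k x = 1 - (2 * Complex.I * k)⁻¹ *
      (jostM' hi k x - ∫ t in Ioi x, (u t : ℂ) * jostM hi k t) := by
  conv_lhs => rw [jostM_eq hc hi hk]
  rw [BoundedContinuousFunction.add_apply, convolveL_apply_Ioi hi (jostKernel_of_nonpos hk),
    jostM', ← integral_const_mul, ← integral_sub ((integrableOn_exp_mul hi hk _ x).const_mul _)
      (integrable_mul_bcf hi _).integrableOn, ← integral_const_mul, sub_eq_add_neg, ← integral_neg]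
  congr 1
  refine setIntegral_congr_fun measurableSet_Ioi fun t ht => ?_
  have e : Complex.exp (2 * Complex.I * k * (max (t - x) 0 : ℝ)) =
      Complex.exp (-(2 * Complex.I * k * x)) * Complex.exp (2 * Complex.I * k * t) := by
    rw [← Complex.exp_add, max_eq_left (sub_nonneg.2 (mem_Ioi.1 ht).le)]
    push_cast
    ring_nf
  simp only [jostKernel_apply hk, e]
  ring

theorem hasDerivAt_cexp_mul (c : ℂ) (x : ℝ) :
    HasDerivAt (fun y : ℝ => Complex.exp (c * y)) (c * Complex.exp (c * x)) x := by
  have h := ((Complex.ofRealCLM.hasDerivAt (x := x)).const_mul c).cexp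
  simpa [mul_comm] using h

theorem hasDerivAt_jostM' (hc : Continuous u) (hi : Integrable u) (hk : 0 ≤ k.im) (x : ℝ) :
    HasDerivAt (jostM' hi k) (-(2 * Complex.I * k) * jostM' hi k x - u x * jostM hi k x) x := by
  have h1 := hasDerivAt_cexp_mul (-(2 * Complex.I * k)) x
  have h2 := hasDerivAt_integral_Ioi
    (f := fun t : ℝ => Complex.exp (2 * Complex.I * k * t) * ((u t : ℂ) * jostM hi k t))
    (by fun_prop) (integrableOn_exp_mul hi hk _) x
  have h := h1.mul h2
  have e : Complex.exp (-(2 * Complex.I * k) * x) * Complex.exp (2 * Complex.I * k * x) = 1 := by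
    rw [← Complex.exp_add]; simp
  have e' : ∀ y : ℝ, -(2 * Complex.I * k * (y : ℂ)) = -(2 * Complex.I * k) * y := fun y => by ring
  have h' := h.congr_of_eventuallyEq (f₁ := jostM' hi k)
    (Eventually.of_forall fun y => by simp only [jostM', e', Pi.mul_apply])
  refine h'.congr_deriv ?_
  simp only [jostM', e']
  linear_combination -(u x * jostM hi k x) * e

theorem hasDerivAt_jostM (hc : Continuous u) (hi : Integrable u) (hk : 0 ≤ k.im) (hk0 : k ≠ 0)
    (x : ℝ) : HasDerivAt (jostM hi k) (jostM' hi k x) x := by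
  have h2 := hasDerivAt_integral_Ioi (f := fun t : ℝ => ((u t : ℂ) * jostM hi k t))
    (by fun_prop) (fun _ => (integrable_mul_bcf hi _).integrableOn) x
  have h := (((hasDerivAt_jostM' hc hi hk x).sub h2).const_mul (2 * Complex.I * k)⁻¹).const_sub 1
  have h' : HasDerivAt (jostM hi k) _ x :=
    h.congr_of_eventuallyEq (Eventually.of_forall (jostM_apply hc hi hk))
  refine h'.congr_deriv ?_
  have := Complex.I_ne_zero
  field_simp
  ring

theorem norm_jostM'_le (hi : Integrable u) (hk : 0 ≤ k.im) (x : ℝ) :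
    ‖jostM' hi k x‖ ≤ ‖jostM hi k‖ * tail u x := by
  rw [jostM', ← integral_const_mul, tail, ← integral_const_mul]
  refine norm_integral_le_of_norm_le (hi.abs.integrableOn.const_mul _)
    ((ae_restrict_iff' measurableSet_Ioi).2 (ae_of_all _ fun t ht => ?_))
  rw [← mul_assoc, ← Complex.exp_add, norm_mul, norm_mul, Complex.norm_real, Real.norm_eq_abs]
  have e : -(2 * Complex.I * k * x) + 2 * Complex.I * k * t =
      2 * Complex.I * k * (t - x : ℝ) := by push_cast; ring
  rw [e]
  calc _ ≤ 1 * (|u t| * ‖jostM hi k‖) := by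
        gcongr
        · exact norm_exp_two_I_mul_le hk (sub_nonneg.2 (mem_Ioi.1 ht).le)
        · exact norm_coe_le_norm _ _
    _ = _ := by ring

theorem tendsto_jostM' (hi : Integrable u) (hk : 0 ≤ k.im) :
    Tendsto (jostM' hi k) atTop (𝓝 0) :=
  squeeze_zero_norm (norm_jostM'_le hi hk)
    (by simpa using (tendsto_tail u).const_mul ‖jostM hi k‖)

theorem tendsto_jostM (hc : Continuous u) (hi : Integrable u) (hk : 0 ≤ k.im) :
    Tendsto (jostM hi k) atTop (𝓝 1) := by
  have h : Tendsto (fun x => ∫ t in Ioi x, (u t : ℂ) * jostM hi k t) atTop (𝓝 0) :=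
    tendsto_integral_Ioi_zero tendsto_id
  have h1 := (((tendsto_jostM' hi hk).sub h).const_mul (2 * Complex.I * k)⁻¹).const_sub 1
  rw [sub_zero, mul_zero, sub_zero] at h1
  exact h1.congr fun x => (jostM_apply hc hi hk x).symm

/-- The right Jost solution, constructed from the integral equation. -/
def jostFun (hi : Integrable u) (k : ℂ) (x : ℝ) : ℂ :=
  Complex.exp (Complex.I * k * x) * jostM hi k x

theorem hasDerivAt_jostFun (hc : Continuous u) (hi : Integrable u) (hk : 0 ≤ k.im) (hk0 : k ≠ 0)
    (x : ℝ) : HasDerivAt (jostFun hi k)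
      (Complex.exp (Complex.I * k * x) * (jostM' hi k x + Complex.I * k * jostM hi k x)) x := by
  refine ((hasDerivAt_cexp_mul (Complex.I * k) x).mul
    (hasDerivAt_jostM hc hi hk hk0 x)).congr_deriv ?_
  ring

theorem isSchrodingerSolution_jostFun (hc : Continuous u) (hi : Integrable u) (hk : 0 ≤ k.im)
    (hk0 : k ≠ 0) : IsSchrodingerSolution u k (jostFun hi k) ∧ deriv (jostFun hi k) = fun x : ℝ =>
      Complex.exp (Complex.I * k * x) * (jostM' hi k x + Complex.I * k * jostM hi k x) := by
  refine isSchrodingerSolution_of_hasDerivAt hc (hasDerivAt_jostFun hc hi hk hk0) fun x => ?_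
  refine ((hasDerivAt_cexp_mul (Complex.I * k) x).mul ((hasDerivAt_jostM' hc hi hk x).add
    ((hasDerivAt_jostM hc hi hk hk0 x).const_mul (Complex.I * k)))).congr_deriv ?_
  simp only [jostFun, Pi.add_apply]
  linear_combination (k ^ 2 * Complex.exp (Complex.I * k * x) * jostM hi k x) * Complex.I_sq

theorem isRightJost_jostFun (hc : Continuous u) (hi : Integrable u) (hk : 0 ≤ k.im)
    (hk0 : k ≠ 0) : IsRightJost u k (jostFun hi k) := by
  obtain ⟨h, hd⟩ := isSchrodingerSolution_jostFun hc hi hk hk0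
  have e : ∀ x : ℝ, Complex.exp (Complex.I * k * x) * Complex.exp (-(Complex.I * k * x)) = 1 :=
    fun x => by rw [← Complex.exp_add]; simp
  refine ⟨h, (tendsto_jostM hc hi hk).congr fun x => ?_, ?_⟩
  · rw [jostFun]; linear_combination -jostM hi k x * e x
  · rw [hd]
    have h1 := (tendsto_jostM' hi hk).add ((tendsto_jostM hc hi hk).const_mul (Complex.I * k))
    rw [zero_add, mul_one] at h1
    exact h1.congr fun x => by
      linear_combination -(jostM' hi k x + Complex.I * k * jostM hi k x) * e x

end JostSolution

/-! ### Uniqueness, reflection and conjugation -/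

section Uniqueness

variable {u : ℝ → ℝ} {k : ℂ} {f g : ℝ → ℂ}

theorem hasDerivAt_solution (hf : IsSchrodingerSolution u k f) (x : ℝ) :
    HasDerivAt f (deriv f x) x :=
  (hf.contDiff.differentiable (by norm_num) x).hasDerivAt

theorem hasDerivAt_deriv_solution (hf : IsSchrodingerSolution u k f) (x : ℝ) :
    HasDerivAt (deriv f) (-((u x : ℂ) + k ^ 2) * f x) x := by
  have h2 : ContDiff ℝ (1 + 1) f := by simpa [one_add_one_eq_two] using hf.contDiff
  have h1 : ContDiff ℝ 1 (deriv f) := (contDiff_succ_iff_deriv.1 h2).2.2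
  refine (h1.differentiable (by norm_num) x).hasDerivAt.congr_deriv ?_
  linear_combination hf.eqn x

theorem isSchrodingerSolution_const_mul (hu : Continuous u) (c : ℂ)
    (hf : IsSchrodingerSolution u k f) :
    IsSchrodingerSolution u k (fun x => c * f x) ∧
      deriv (fun x => c * f x) = fun x => c * deriv f x :=
  isSchrodingerSolution_of_hasDerivAt hu (fun x => (hasDerivAt_solution hf x).const_mul c)
    fun x => ((hasDerivAt_deriv_solution hf x).const_mul c).congr_deriv (by ring)

theorem isSchrodingerSolution_sub (hu : Continuous u)
    (hf : IsSchrodingerSolution u k f) (hg : IsSchrodingerSolution u k g) :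
    IsSchrodingerSolution u k (fun x => f x - g x) ∧
      deriv (fun x => f x - g x) = fun x => deriv f x - deriv g x :=
  isSchrodingerSolution_of_hasDerivAt hu
    (fun x => (hasDerivAt_solution hf x).sub (hasDerivAt_solution hg x))
    fun x => ((hasDerivAt_deriv_solution hf x).sub
      (hasDerivAt_deriv_solution hg x)).congr_deriv (by ring)

theorem deriv_comp_neg' (f : ℝ → ℂ) : deriv (fun x => f (-x)) = fun x => -deriv f (-x) :=
  funext (deriv_comp_neg f)

theorem isSchrodingerSolution_comp_neg (hu : Continuous u) (hf : IsSchrodingerSolution u k f) :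
    IsSchrodingerSolution (fun x => u (-x)) k (fun x => f (-x)) :=
  (isSchrodingerSolution_of_hasDerivAt (f' := fun x => -deriv f (-x)) (by fun_prop)
    (fun x => by
      have h := (hasDerivAt_solution hf (-x)).scomp x (hasDerivAt_neg x)
      rw [neg_one_smul] at h
      exact h)
    (fun x => by
      have h := ((hasDerivAt_deriv_solution hf (-x)).scomp x (hasDerivAt_neg x)).neg
      refine h.congr_deriv ?_
      simp)).1

/-- Since `u` is real, conjugation turns `k²` into its conjugate. The root `-k̄` is the one that
stays in the upper half-plane and matches the conjugate of `e^{ikx}`. -/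
theorem isSchrodingerSolution_conj (hu : Continuous u) (hf : IsSchrodingerSolution u k f) :
    IsSchrodingerSolution u (-(starRingEnd ℂ k)) (fun x => starRingEnd ℂ (f x)) ∧
      deriv (fun x => starRingEnd ℂ (f x)) = fun x => starRingEnd ℂ (deriv f x) :=
  isSchrodingerSolution_of_hasDerivAt hu (fun x => (hasDerivAt_solution hf x).star)
    fun x => (hasDerivAt_deriv_solution hf x).star.congr_deriv (by simp)

/-- Grönwall for the pair `(f, f')`, whose derivative is bounded by `max 1 M` times its norm on the
compact interval. -/
theorem solution_eq_zero_of_le (hu : Continuous u) (hf : IsSchrodingerSolution u k f) {a : ℝ}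
    (h0 : f a = 0) (h1 : deriv f a = 0) (x : ℝ) (hx : a ≤ x) : f x = 0 := by
  obtain ⟨M, hM⟩ := isCompact_Icc.exists_bound_of_continuousOn (s := Icc a x)
    (f := fun t => -((u t : ℂ) + k ^ 2)) (by fun_prop)
  have hd : ∀ t, HasDerivAt (fun t => (f t, deriv f t))
      (deriv f t, -((u t : ℂ) + k ^ 2) * f t) t := fun t =>
    (hasDerivAt_solution hf t).prodMk (hasDerivAt_deriv_solution hf t)
  have h := eq_zero_of_abs_deriv_le_mul_abs_self_of_eq_zero_right (K := max 1 M) (a := a) (b := x)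
    (fun t _ => (hd t).continuousAt.continuousWithinAt) (fun t _ => (hd t).hasDerivWithinAt)
    (by simp [h0, h1]) (fun t ht => ?_) x ⟨hx, le_rfl⟩
  · exact congrArg Prod.fst h
  · have hf1 : ‖f t‖ ≤ ‖(f t, deriv f t)‖ := norm_fst_le (f t, deriv f t)
    have hf2 : ‖deriv f t‖ ≤ ‖(f t, deriv f t)‖ := norm_snd_le (f t, deriv f t)
    refine (Prod.norm_def _).trans_le (max_le ?_ ?_)
    · exact hf2.trans (le_mul_of_one_le_left (norm_nonneg _) (le_max_left _ _))
    · rw [norm_mul]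
      exact mul_le_mul ((hM t ⟨ht.1, ht.2.le⟩).trans (le_max_right _ _)) hf1 (norm_nonneg _)
        (zero_le_one.trans (le_max_left _ _))

theorem solution_eq_zero (hu : Continuous u) (hf : IsSchrodingerSolution u k f) {a : ℝ}
    (h0 : f a = 0) (h1 : deriv f a = 0) (x : ℝ) : f x = 0 := by
  rcases le_total a x with h | h
  · exact solution_eq_zero_of_le hu hf h0 h1 x h
  · have := solution_eq_zero_of_le (a := -a) (u := fun x => u (-x)) (by fun_prop)
      (isSchrodingerSolution_comp_neg hu hf) (by simpa using h0)
      (by rw [deriv_comp_neg]; simpa using h1) (-x) (by linarith)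
    simpa using this

/-- At a point `a` with `g a ≠ 0`, the solution `f - (f a / g a) g` has vanishing Cauchy data. -/
theorem eq_const_mul_of_wronskian_eq_zero (hu : Continuous u) (hf : IsSchrodingerSolution u k f)
    (hg : IsSchrodingerSolution u k g) (hW : wronskianFn f g 0 = 0) (hg0 : ∃ x, g x ≠ 0) :
    ∃ c : ℂ, ∀ x, f x = c * g x := by
  obtain ⟨a, ha⟩ := hg0
  have hWa := wronskianFn_eq hf hg a 0
  rw [hW, wronskianFn] at hWa
  refine ⟨f a / g a, fun x => ?_⟩
  obtain ⟨h1, h2⟩ := isSchrodingerSolution_const_mul hu (f a / g a) hg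
  obtain ⟨h3, h4⟩ := isSchrodingerSolution_sub hu hf h1
  refine sub_eq_zero.1 (solution_eq_zero hu h3 (a := a) ?_ ?_ x)
  · field_simp; simp
  · rw [h4, h2]
    field_simp
    linear_combination -hWa

theorem rightJost_exists_ne_zero (hf : IsRightJost u k f) : ∃ x, f x ≠ 0 := by
  by_contra! h
  have := hf.tendsto
  simp only [h, zero_mul] at this
  exact zero_ne_one (tendsto_nhds_unique tendsto_const_nhds this)

/-- The constant Wronskian equals `e^{2ikx}`, bounded for `x ≥ 0`, times a quantity tending to `ik -
ik = 0`. So the two solutions are proportional, and the normalisation at `+∞` makes the factor `1`.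
-/
theorem rightJost_unique (hu : Continuous u) (hk : 0 ≤ k.im) (hf : IsRightJost u k f)
    (hg : IsRightJost u k g) : f = g := by
  have hW : wronskianFn f g 0 = 0 := by
    have h := (hf.tendsto.mul hg.tendsto_deriv).sub (hg.tendsto.mul hf.tendsto_deriv)
    rw [sub_self] at h
    have h1 : Tendsto (fun _ : ℝ => wronskianFn f g 0) atTop (𝓝 0) := by
      refine squeeze_zero_norm' ?_ (tendsto_zero_iff_norm_tendsto_zero.1 h)
      filter_upwards [eventually_ge_atTop 0] with x hx
      have e : wronskianFn f g 0 = Complex.exp (2 * Complex.I * k * x) *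
          (f x * Complex.exp (-(Complex.I * k * x)) *
            (deriv g x * Complex.exp (-(Complex.I * k * x))) -
          g x * Complex.exp (-(Complex.I * k * x)) *
            (deriv f x * Complex.exp (-(Complex.I * k * x)))) := by
        have e1 : Complex.exp (2 * Complex.I * k * x) * Complex.exp (-(Complex.I * k * x)) *
            Complex.exp (-(Complex.I * k * x)) = 1 := by
          rw [← Complex.exp_add, ← Complex.exp_add, Complex.exp_eq_one_iff]
          exact ⟨0, by push_cast; ring⟩
        rw [wronskianFn_eq hf.solution hg.solution 0 x, wronskianFn]
        linear_combination -(f x * deriv g x - g x * deriv f x) * e1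
      rw [e, norm_mul]
      exact mul_le_of_le_one_left (norm_nonneg _) (norm_exp_two_I_mul_le hk hx)
    exact tendsto_nhds_unique tendsto_const_nhds h1
  obtain ⟨c, hc⟩ := eq_const_mul_of_wronskian_eq_zero hu hf.solution hg.solution hW
    (rightJost_exists_ne_zero hg)
  have h := (hg.tendsto.const_mul c).congr fun x => by
    rw [← mul_assoc, ← hc]
  have hc1 : c * 1 = 1 := tendsto_nhds_unique h hf.tendsto
  funext x
  rw [hc x, ← mul_one c, hc1, one_mul]

/-- Through this equivalence all statements about left Jost solutions follow from those about right
ones for `u(-x)`. -/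
theorem isLeftJost_iff (hu : Continuous u) : IsLeftJost u k f ↔
    IsRightJost (fun x => u (-x)) k (fun x => f (-x)) := by
  constructor
  · intro h
    refine ⟨isSchrodingerSolution_comp_neg hu h.solution, ?_, ?_⟩
    · refine (h.tendsto.comp tendsto_neg_atTop_atBot).congr fun x => ?_
      simp
    · rw [deriv_comp_neg']
      have h1 := (h.tendsto_deriv.comp tendsto_neg_atTop_atBot).neg
      rw [neg_neg] at h1
      refine h1.congr fun x => ?_
      simp
  · intro h
    have hs := isSchrodingerSolution_comp_neg (by fun_prop) h.solution
    simp only [neg_neg] at hs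
    refine ⟨hs, ?_, ?_⟩
    · refine (h.tendsto.comp tendsto_neg_atBot_atTop).congr fun x => ?_
      simp
    · have h1 := (h.tendsto_deriv.comp tendsto_neg_atBot_atTop).neg
      refine h1.congr fun x => ?_
      simp [deriv_comp_neg']

theorem jostPsi_eq (hc : Continuous u) (hi : Integrable u) (hk : 0 ≤ k.im) (hk0 : k ≠ 0) :
    jostPsi u k = jostFun hi k :=
  rightJost_unique hc hk (Classical.epsilon_spec ⟨_, isRightJost_jostFun hc hi hk hk0⟩)
    (isRightJost_jostFun hc hi hk hk0)

theorem isLeftJost_jostPhi (hc : Continuous u) (hi : Integrable u) (hk : 0 ≤ k.im)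
    (hk0 : k ≠ 0) : IsLeftJost u k (jostPhi u k) := by
  refine Classical.epsilon_spec ⟨fun x => jostFun hi.comp_neg k (-x), ?_⟩
  rw [isLeftJost_iff hc]
  simpa using isRightJost_jostFun (u := fun x => u (-x)) (by fun_prop) hi.comp_neg hk hk0

theorem jostPhi_eq (hc : Continuous u) (hi : Integrable u) (hk : 0 ≤ k.im) (hk0 : k ≠ 0) :
    jostPhi u k = fun x => jostFun hi.comp_neg k (-x) := by
  have h1 := (isLeftJost_iff hc).1 (isLeftJost_jostPhi hc hi hk hk0)
  have h2 := isRightJost_jostFun (u := fun x => u (-x)) (by fun_prop) hi.comp_neg hk hk0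
  have h := rightJost_unique (by fun_prop) hk h1 h2
  funext x
  simpa using congrFun h (-x)

theorem scatteringB_eq (hc : Continuous u) (hi : Integrable u) (hk : 0 ≤ k.im) (hk0 : k ≠ 0) :
    scatteringB u k = (jostFun hi.comp_neg k 0 * deriv (jostFun hi k) 0 +
      jostFun hi k 0 * deriv (jostFun hi.comp_neg k) 0) / (2 * Complex.I * k) := by
  rw [scatteringB, wronskianFn, jostPsi_eq hc hi hk hk0, jostPhi_eq hc hi hk hk0, deriv_comp_neg]
  simp

theorem isRightJost_conj (hu : Continuous u) (hf : IsRightJost u k f) :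
    IsRightJost u (-(starRingEnd ℂ k)) (fun x => starRingEnd ℂ (f x)) := by
  obtain ⟨h, hd⟩ := isSchrodingerSolution_conj hu hf.solution
  have e : ∀ x : ℝ, Complex.exp (-(Complex.I * -(starRingEnd ℂ k) * x)) =
      starRingEnd ℂ (Complex.exp (-(Complex.I * k * x))) := fun x => by
    rw [← Complex.exp_conj]; simp
  refine ⟨h, ?_, ?_⟩
  · have := (Complex.continuous_conj.tendsto _).comp hf.tendsto
    rw [map_one] at this
    exact this.congr fun x => by simp only [Function.comp, map_mul, e]
  · have := (Complex.continuous_conj.tendsto _).comp hf.tendsto_deriv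
    rw [hd]
    convert this.congr fun x => _ using 2
    · simp
    · simp only [Function.comp, map_mul, e]

end Uniqueness

/-! ### Analytic dependence on the spectral parameter -/

section Analytic

variable {u : ℝ → ℝ} {k : ℂ}

theorem norm_cexp_two_I_mul (k : ℂ) (y : ℝ) :
    ‖Complex.exp (2 * Complex.I * k * y)‖ = Real.exp (-(2 * k.im * y)) := by
  rw [Complex.norm_exp]
  congr 1
  simp

/-- The derivative `y ↦ 2iy⁺ e^{2iky⁺}` of `expKernel` with respect to `k`. -/
def expKernelDeriv (hk : 0 < k.im) : ℝ →ᵇ ℂ :=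
  ofNormedAddCommGroup (fun y : ℝ => 2 * Complex.I * (max y 0 : ℝ) *
      Complex.exp (2 * Complex.I * k * (max y 0 : ℝ)))
    (by fun_prop) (1 / k.im) (fun y => by
      have hy : 0 ≤ max y 0 := le_max_right y 0
      set z := max y 0
      -- The bound `1 / Im k` comes from `t ≤ e^t` at `t = 2 (Im k) z`.
      rw [norm_mul, norm_cexp_two_I_mul, Real.exp_neg, le_div_iff₀ hk, ← div_eq_mul_inv,
        div_mul_eq_mul_div, div_le_one (Real.exp_pos _)]
      have : ‖(2 * Complex.I * z : ℂ)‖ = 2 * z := by simp [abs_of_nonneg hy]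
      rw [this]
      linarith [Real.add_one_le_exp (2 * k.im * z)])

/-- The derivative is in the sup norm over all `y`. With `w = 2i(k' - k)z`, the Taylor remainder is
at most `|w|² e^{|w|}`, while the kernel contributes decay `e^{-2 (Im k) z}`. On the ball of radius
`Im k / 2` half of this decay absorbs `e^{|w|}`, and the other half absorbs the factor `z²`. -/
theorem hasDerivAt_expKernel (hk : 0 < k.im) :
    HasDerivAt expKernel (expKernelDeriv hk) k := by
  rw [hasDerivAt_iff_isLittleO]
  refine Asymptotics.IsBigO.trans_isLittleO ?_ (Asymptotics.isLittleO_pow_sub_sub k one_lt_two)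
  -- The constant arises from `(2hz)² = (8 / (Im k)²) h² · ((Im k) z)² / 2`, the last factor being
  -- at most `e^{(Im k) z}`.
  refine Asymptotics.IsBigO.of_bound (8 / k.im ^ 2) ?_
  filter_upwards [Metric.ball_mem_nhds k (half_pos hk)] with k' hk'
  rw [Metric.mem_ball, dist_eq_norm] at hk'
  have him : 0 ≤ k'.im := by
    have := (Complex.abs_im_le_norm (k' - k)).trans hk'.le
    rw [Complex.sub_im, abs_le] at this
    linarith [this.1]
  rw [norm_pow, norm_norm]
  refine (BoundedContinuousFunction.norm_le (by positivity)).2 fun y => ?_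
  have hy : 0 ≤ max y 0 := le_max_right y 0
  have e : (expKernel k' - expKernel k - (k' - k) • expKernelDeriv hk) y =
      Complex.exp (2 * Complex.I * k * (max y 0 : ℝ)) *
        (Complex.exp (2 * Complex.I * (k' - k) * (max y 0 : ℝ)) -
          ∑ m ∈ Finset.range 2, (2 * Complex.I * (k' - k) * (max y 0 : ℝ)) ^ m / m.factorial) := by
    have e1 : Complex.exp (2 * Complex.I * k' * (max y 0 : ℝ)) =
        Complex.exp (2 * Complex.I * k * (max y 0 : ℝ)) *
          Complex.exp (2 * Complex.I * (k' - k) * (max y 0 : ℝ)) := by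
      rw [← Complex.exp_add]; ring_nf
    rw [BoundedContinuousFunction.sub_apply, BoundedContinuousFunction.sub_apply,
      BoundedContinuousFunction.smul_apply, expKernel_apply him, expKernel_apply hk.le, e1]
    simp only [expKernelDeriv, coe_ofNormedAddCommGroup, Finset.sum_range_succ, smul_eq_mul]
    simp
    ring
  rw [e, norm_mul, norm_cexp_two_I_mul]
  set z := max y 0
  set h := ‖k' - k‖ with hh
  have hw : ‖2 * Complex.I * (k' - k) * (z : ℂ)‖ = 2 * h * z := by
    simp [abs_of_nonneg hy, hh]
  have h1 := Complex.norm_exp_sub_sum_le_norm_mul_exp (2 * Complex.I * (k' - k) * (z : ℂ)) 2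
  rw [hw] at h1
  have h2 : Real.exp (2 * h * z) ≤ Real.exp (k.im * z) :=
    Real.exp_le_exp.2 (by nlinarith)
  have h3 : (k.im * z) ^ 2 / 2 ≤ Real.exp (k.im * z) := by
    have := Real.quadratic_le_exp_of_nonneg (mul_nonneg hk.le hy)
    have := mul_nonneg hk.le hy
    linarith
  have h4 : Real.exp (-(2 * k.im * z)) * (Real.exp (k.im * z) * Real.exp (k.im * z)) = 1 := by
    rw [← Real.exp_add, ← Real.exp_add, Real.exp_eq_one_iff]; ring
  calc _ ≤ Real.exp (-(2 * k.im * z)) * ((2 * h * z) ^ 2 * Real.exp (k.im * z)) := by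
        gcongr
        exact h1.trans (by gcongr)
    _ = (8 / k.im ^ 2 * h ^ 2) * (Real.exp (-(2 * k.im * z)) *
          ((k.im * z) ^ 2 / 2 * Real.exp (k.im * z))) := by
        field_simp; ring
    _ ≤ (8 / k.im ^ 2 * h ^ 2) * (Real.exp (-(2 * k.im * z)) *
          (Real.exp (k.im * z) * Real.exp (k.im * z))) := by gcongr
    _ = _ := by rw [h4, mul_one]

theorem ne_zero_of_im_pos (hk : 0 < k.im) : k ≠ 0 := by
  rintro rfl
  simp at hk

theorem differentiableAt_inverse_one_sub {R : Type*} [NormedRing R] [CompleteSpace R]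
    [NormedAlgebra ℂ R] {T : ℂ → R} (hT : DifferentiableAt ℂ T k) (hu : IsUnit (1 - T k)) :
    DifferentiableAt ℂ (fun k => Ring.inverse (1 - T k)) k :=
  DifferentiableAt.comp (g := Ring.inverse) (f := fun k => 1 - T k) k
    (differentiableAt_inverse (𝕜 := ℂ) hu) (hT.const_sub 1)

theorem differentiableAt_clm_comp {E F : Type*} [NormedAddCommGroup E] [NormedSpace ℂ E]
    [NormedAddCommGroup F] [NormedSpace ℂ F] (L : E →L[ℂ] F) {T : ℂ → E}
    (hT : DifferentiableAt ℂ T k) : DifferentiableAt ℂ (fun k => L (T k)) k :=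
  DifferentiableAt.comp (g := L) (f := T) k L.differentiableAt hT

theorem differentiableAt_jostM (hc : Continuous u) (hi : Integrable u) (hk : 0 < k.im) :
    DifferentiableAt ℂ (jostM hi) k := by
  have h0 : 2 * Complex.I * k ≠ 0 :=
    mul_ne_zero (mul_ne_zero two_ne_zero Complex.I_ne_zero) (ne_zero_of_im_pos hk)
  have h1 : DifferentiableAt ℂ jostKernel k := by
    have h2 : DifferentiableAt ℂ (fun k : ℂ => -(2 * Complex.I * k)⁻¹) k :=
      ((differentiableAt_id.const_mul _).inv h0).neg
    exact h2.smul ((hasDerivAt_expKernel hk).differentiableAt.sub_const 1)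
  have h2 : DifferentiableAt ℂ (fun k => convolveL hi (jostKernel k)) k :=
    differentiableAt_clm_comp (E := ℝ →ᵇ ℂ) (F := (ℝ →ᵇ ℂ) →L[ℂ] (ℝ →ᵇ ℂ)) (convolveL hi) h1
  have h3 := differentiableAt_inverse_one_sub (R := (ℝ →ᵇ ℂ) →L[ℂ] (ℝ →ᵇ ℂ)) h2
    (isUnit_one_sub_convolveL hc hi (jostKernel_of_nonpos hk.le))
  exact h3.clm_apply (differentiableAt_const _)

/-- The functional `m ↦ ∫_0^∞ u(t) m(t) dt`. -/
def integralL (hi : Integrable u) : (ℝ →ᵇ ℂ) →L[ℂ] ℂ :=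
  LinearMap.mkContinuous
    { toFun := fun m => ∫ t in Ioi 0, (u t : ℂ) * m t
      map_add' := fun m₁ m₂ => by
        rw [← integral_add (integrable_mul_bcf hi _).integrableOn
          (integrable_mul_bcf hi _).integrableOn]
        simp [mul_add]
      map_smul' := fun c m => by
        rw [RingHom.id_apply, smul_eq_mul, ← integral_const_mul]
        exact integral_congr_ae (ae_of_all _ fun t => by simp; ring) }
    (∫ t in Ioi 0, |u t|) (fun m => by
      rw [← integral_mul_const]
      refine norm_integral_le_of_norm_le (hi.abs.integrableOn.mul_const _)
        (ae_of_all _ fun t => ?_)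
      rw [norm_mul, Complex.norm_real, Real.norm_eq_abs]
      exact mul_le_mul_of_nonneg_left (m.norm_coe_le_norm t) (abs_nonneg _))

/-- This form, a fixed continuous functional applied to a product of functions differentiable in
`k`, makes the derivative of `ψ_k` at `0` differentiable in `k`. -/
theorem jostM'_zero (hi : Integrable u) (hk : 0 ≤ k.im) :
    jostM' hi k 0 = integralL hi (expKernel k * jostM hi k) := by
  have e : integralL hi (expKernel k * jostM hi k) =
    ∫ t in Ioi 0, (u t : ℂ) * (expKernel k * jostM hi k) t := rfl
  rw [e, jostM']
  simp only [Complex.ofReal_zero, mul_zero, neg_zero, Complex.exp_zero, one_mul]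
  refine setIntegral_congr_fun measurableSet_Ioi fun t ht => ?_
  simp only [BoundedContinuousFunction.mul_apply, expKernel_apply hk,
    max_eq_left (mem_Ioi.1 ht).le]
  ring

theorem eventually_im_pos (hk : 0 < k.im) : ∀ᶠ k' in 𝓝 k, 0 < k'.im :=
  Complex.continuous_im.continuousAt.eventually (lt_mem_nhds hk)

theorem differentiableAt_jostM_apply (hc : Continuous u) (hi : Integrable u) (hk : 0 < k.im)
    (x : ℝ) : DifferentiableAt ℂ (fun k => jostM hi k x) k :=
  differentiableAt_clm_comp (BoundedContinuousFunction.evalCLM (β := ℂ) ℂ x)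
    (differentiableAt_jostM hc hi hk)

theorem differentiableAt_jostFun_zero (hc : Continuous u) (hi : Integrable u) (hk : 0 < k.im) :
    DifferentiableAt ℂ (fun k => jostFun hi k 0) k := by
  simpa [jostFun] using differentiableAt_jostM_apply hc hi hk 0

theorem differentiableAt_deriv_jostFun_zero (hc : Continuous u) (hi : Integrable u)
    (hk : 0 < k.im) : DifferentiableAt ℂ (fun k => deriv (jostFun hi k) 0) k := by
  have h1 : DifferentiableAt ℂ (fun k => integralL hi (expKernel k * jostM hi k) +
      Complex.I * k * jostM hi k 0) k :=
    ((integralL hi).differentiableAt.comp k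
      ((hasDerivAt_expKernel hk).differentiableAt.mul (differentiableAt_jostM hc hi hk))).add
      ((differentiableAt_id.const_mul _).mul (differentiableAt_jostM_apply hc hi hk 0))
  refine h1.congr_of_eventuallyEq ?_
  filter_upwards [eventually_im_pos hk] with k' hk'
  rw [(isSchrodingerSolution_jostFun hc hi hk'.le (ne_zero_of_im_pos hk')).2,
    ← jostM'_zero hi hk'.le]
  simp

end Analytic

/-! ### Green's identity on the half-line -/

section Pairing

variable {u : ℝ → ℝ} {k l : ℂ} {f g : ℝ → ℂ}

theorem hasDerivAt_wronskianFn (hf : IsSchrodingerSolution u k f)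
    (hg : IsSchrodingerSolution u l g) (x : ℝ) :
    HasDerivAt (wronskianFn f g) ((k ^ 2 - l ^ 2) * (f x * g x)) x := by
  refine (((hasDerivAt_solution hf x).mul (hasDerivAt_deriv_solution hg x)).sub
    ((hasDerivAt_solution hg x).mul (hasDerivAt_deriv_solution hf x))).congr_deriv ?_
  ring

theorem norm_cexp_I_mul (k : ℂ) (x : ℝ) :
    ‖Complex.exp (Complex.I * k * x)‖ = Real.exp (-(k.im * x)) := by
  rw [Complex.norm_exp]
  congr 1
  simp

theorem norm_jostFun_le (hi : Integrable u) (k : ℂ) (x : ℝ) :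
    ‖jostFun hi k x‖ ≤ ‖jostM hi k‖ * Real.exp (-(k.im * x)) := by
  rw [jostFun, norm_mul, norm_cexp_I_mul, mul_comm]
  gcongr
  exact norm_coe_le_norm _ _

theorem norm_deriv_jostFun_le (hc : Continuous u) (hi : Integrable u) (hk : 0 ≤ k.im)
    (hk0 : k ≠ 0) (x : ℝ) : ‖deriv (jostFun hi k) x‖ ≤
      (‖jostM hi k‖ * (∫ t, |u t|) + ‖k‖ * ‖jostM hi k‖) * Real.exp (-(k.im * x)) := by
  rw [(isSchrodingerSolution_jostFun hc hi hk hk0).2, norm_mul, norm_cexp_I_mul, mul_comm]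
  gcongr
  refine (norm_add_le _ _).trans (add_le_add ?_ ?_)
  · exact (norm_jostM'_le hi hk x).trans (by gcongr; exact tail_le hi x)
  · rw [norm_mul, norm_mul, Complex.norm_I, one_mul]
    gcongr
    exact norm_coe_le_norm _ _

theorem tendsto_exp_neg_mul {s : ℝ} (hs : 0 < s) :
    Tendsto (fun x : ℝ => Real.exp (-(s * x))) atTop (𝓝 0) :=
  Real.tendsto_exp_neg_atTop_nhds_zero.comp (tendsto_id.const_mul_atTop hs)

theorem tendsto_zero_of_norm_le_exp {s C : ℝ} (hs : 0 < s)
    (hf : ∀ x, ‖f x‖ ≤ C * Real.exp (-(s * x))) : Tendsto f atTop (𝓝 0) :=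
  squeeze_zero_norm hf (by simpa using (tendsto_exp_neg_mul hs).const_mul C)

theorem tendsto_jostFun (hi : Integrable u) (hk : 0 < k.im) :
    Tendsto (jostFun hi k) atTop (𝓝 0) :=
  tendsto_zero_of_norm_le_exp hk (norm_jostFun_le hi k)

theorem tendsto_deriv_jostFun (hc : Continuous u) (hi : Integrable u) (hk : 0 < k.im) :
    Tendsto (deriv (jostFun hi k)) atTop (𝓝 0) :=
  tendsto_zero_of_norm_le_exp hk (norm_deriv_jostFun_le hc hi hk.le (ne_zero_of_im_pos hk))

theorem continuous_jostFun (hi : Integrable u) (k : ℂ) : Continuous (jostFun hi k) := by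
  unfold jostFun
  fun_prop

theorem integrableOn_exp_neg {s : ℝ} (hs : 0 < s) (C x : ℝ) :
    IntegrableOn (fun x : ℝ => C * Real.exp (-(s * x))) (Ioi x) := by
  have := (integrableOn_exp_mul_Ioi (neg_lt_zero.2 hs) x).const_mul C
  simp only [neg_mul] at this
  exact this

theorem norm_jostFun_mul_le (hi : Integrable u) (hl : 0 ≤ l.im) {C : ℝ} (hC : ‖jostM hi l‖ ≤ C)
    {x : ℝ} (hx : 0 ≤ x) : ‖jostFun hi k x * jostFun hi l x‖ ≤
      ‖jostM hi k‖ * C * Real.exp (-(k.im * x)) := by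
  rw [norm_mul]
  have h1 := norm_jostFun_le hi k x
  have h2 : ‖jostFun hi l x‖ ≤ C := by
    refine (norm_jostFun_le hi l x).trans ?_
    refine (mul_le_of_le_one_right (norm_nonneg _) ?_).trans hC
    exact Real.exp_le_one_iff.2 (by have := mul_nonneg hl hx; linarith)
  calc _ ≤ ‖jostM hi k‖ * Real.exp (-(k.im * x)) * C := by gcongr
    _ = _ := by ring

theorem integrableOn_jostFun_mul (hi : Integrable u) (hk : 0 < k.im) (hl : 0 ≤ l.im) :
    IntegrableOn (fun x => jostFun hi k x * jostFun hi l x) (Ioi 0) := by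
  refine (integrableOn_exp_neg hk (‖jostM hi k‖ * ‖jostM hi l‖) 0).mono'
    ((continuous_jostFun hi k).mul (continuous_jostFun hi l)).aestronglyMeasurable
    ((ae_restrict_iff' measurableSet_Ioi).2 (ae_of_all _ fun x hx => ?_))
  exact norm_jostFun_mul_le hi hl le_rfl (mem_Ioi.1 hx).le

/-- Integrate the derivative of the Wronskian over `(0, ∞)`; the boundary term at infinity vanishes
because both solutions and their derivatives decay. -/
theorem wronskianFn_jostFun_zero (hc : Continuous u) (hi : Integrable u) (hk : 0 < k.im)
    (hl : 0 < l.im) : wronskianFn (jostFun hi k) (jostFun hi l) 0 =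
      (l ^ 2 - k ^ 2) * ∫ x in Ioi 0, jostFun hi k x * jostFun hi l x := by
  have h1 := (isSchrodingerSolution_jostFun hc hi hk.le (ne_zero_of_im_pos hk)).1
  have h2 := (isSchrodingerSolution_jostFun hc hi hl.le (ne_zero_of_im_pos hl)).1
  have hd := hasDerivAt_wronskianFn h1 h2
  have hlim : Tendsto (wronskianFn (jostFun hi k) (jostFun hi l)) atTop (𝓝 0) := by
    have h := ((tendsto_jostFun hi hk).mul (tendsto_deriv_jostFun hc hi hl)).sub
      ((tendsto_jostFun hi hl).mul (tendsto_deriv_jostFun hc hi hk))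
    rw [mul_zero, sub_zero] at h
    exact h
  have h := integral_Ioi_of_hasDerivAt_of_tendsto (a := 0) (hd 0).continuousAt.continuousWithinAt
    (fun x _ => hd x) ((integrableOn_jostFun_mul hi hk hl.le).const_mul _) hlim
  rw [integral_const_mul] at h
  linear_combination h

theorem tendsto_integral_jostFun_mul (hc : Continuous u) (hi : Integrable u) (hk : 0 < k.im) :
    Tendsto (fun l => ∫ x in Ioi 0, jostFun hi k x * jostFun hi l x) (𝓝 k)
      (𝓝 (∫ x in Ioi 0, jostFun hi k x * jostFun hi k x)) := by
  have hcont := (differentiableAt_jostM hc hi hk).continuousAt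
  have hb : ∀ᶠ l in 𝓝 k, ‖jostM hi l‖ ≤ ‖jostM hi k‖ + 1 :=
    hcont.norm.eventually (ge_mem_nhds (by simp))
  refine tendsto_integral_filter_of_dominated_convergence
    (fun x => ‖jostM hi k‖ * (‖jostM hi k‖ + 1) * Real.exp (-(k.im * x))) ?_ ?_
    (integrableOn_exp_neg hk _ 0) (ae_of_all _ fun x => ?_)
  · exact Eventually.of_forall fun l =>
      ((continuous_jostFun hi k).mul (continuous_jostFun hi l)).aestronglyMeasurable
  · filter_upwards [hb, eventually_im_pos hk] with l hl hl'
    exact (ae_restrict_iff' measurableSet_Ioi).2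
      (ae_of_all _ fun x hx => norm_jostFun_mul_le hi hl'.le hl (mem_Ioi.1 hx).le)
  · have h1 := (differentiableAt_jostM_apply hc hi hk x).continuousAt
    have h2 : ContinuousAt (fun l : ℂ => Complex.exp (Complex.I * l * x)) k := by fun_prop
    exact (h2.mul h1).const_mul (jostFun hi k x)

/-- Both sides are the derivative at `l = k` of `l ↦ W(ψ_k, ψ_l)(0)`: one by linearity of the
Wronskian in its second entry, the other by dividing Green's identity by `l - k` and passing to the
limit under the integral. -/
theorem jostFun_mul_deriv_sub (hc : Continuous u) (hi : Integrable u) (hk : 0 < k.im) :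
    jostFun hi k 0 * deriv (fun l => deriv (jostFun hi l) 0) k -
      deriv (jostFun hi k) 0 * deriv (fun l => jostFun hi l 0) k =
      2 * k * ∫ x in Ioi 0, jostFun hi k x * jostFun hi k x := by
  have h1 := ((differentiableAt_deriv_jostFun_zero hc hi hk).hasDerivAt.const_mul
    (jostFun hi k 0)).sub ((differentiableAt_jostFun_zero hc hi hk).hasDerivAt.const_mul
    (deriv (jostFun hi k) 0))
  have h2 : HasDerivAt (fun l => wronskianFn (jostFun hi k) (jostFun hi l) 0)
      (2 * k * ∫ x in Ioi 0, jostFun hi k x * jostFun hi k x) k := by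
    rw [hasDerivAt_iff_tendsto_slope]
    have h3 : Tendsto (fun l => (l + k) * ∫ x in Ioi 0, jostFun hi k x * jostFun hi l x)
        (𝓝[≠] k) (𝓝 (2 * k * ∫ x in Ioi 0, jostFun hi k x * jostFun hi k x)) := by
      rw [two_mul]
      exact ((tendsto_id.add_const k).mul
        (tendsto_integral_jostFun_mul hc hi hk)).mono_left nhdsWithin_le_nhds
    refine h3.congr' ?_
    filter_upwards [self_mem_nhdsWithin, (eventually_im_pos hk).filter_mono nhdsWithin_le_nhds]
      with l hl hl'
    have hne : l - k ≠ 0 := sub_ne_zero.2 hl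
    rw [slope_def_field, wronskianFn_jostFun_zero hc hi hk hl', wronskianFn_jostFun_zero hc hi hk hk]
    field_simp
    ring
  refine h1.unique (h2.congr_of_eventuallyEq (Eventually.of_forall fun l => ?_))
  simp only [wronskianFn, Pi.sub_apply]
  ring

end Pairing

/-! ### Exponential decay and orthogonality -/

section Decay

variable {E : Type*} [NormedAddCommGroup E] {u : ℝ → ℝ} {k l : ℂ}

/-- Exponential decay at both ends of the line. -/
def ExpDecay (f : ℝ → E) : Prop := ∃ C s : ℝ, 0 < s ∧ ∀ x, ‖f x‖ ≤ C * Real.exp (-(s * |x|))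

theorem ExpDecay.tendsto_atTop {f : ℝ → E} (hf : ExpDecay f) : Tendsto f atTop (𝓝 0) := by
  obtain ⟨C, s, hs, h⟩ := hf
  refine squeeze_zero_norm h ?_
  simpa using ((tendsto_exp_neg_mul hs).comp tendsto_abs_atTop_atTop).const_mul C

theorem ExpDecay.tendsto_atBot {f : ℝ → E} (hf : ExpDecay f) : Tendsto f atBot (𝓝 0) := by
  obtain ⟨C, s, hs, h⟩ := hf
  refine squeeze_zero_norm h ?_
  simpa using ((tendsto_exp_neg_mul hs).comp tendsto_abs_atBot_atTop).const_mul C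

theorem ExpDecay.bounded {f : ℝ → E} (hf : ExpDecay f) : ∃ C, 0 ≤ C ∧ ∀ x, ‖f x‖ ≤ C := by
  obtain ⟨C, s, hs, h⟩ := hf
  have hC : 0 ≤ C := by simpa using (norm_nonneg _).trans (h 0)
  refine ⟨C, hC, fun x => (h x).trans (mul_le_of_le_one_right hC ?_)⟩
  exact Real.exp_le_one_iff.2 (by have := mul_nonneg hs.le (abs_nonneg x); linarith)

theorem ExpDecay.integrable {f : ℝ → E} (hf : ExpDecay f) (hc : Continuous f) : Integrable f := by
  obtain ⟨C, s, hs, h⟩ := hf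
  refine Integrable.mono' ?_ hc.aestronglyMeasurable (ae_of_all _ h)
  refine Integrable.const_mul ?_ C
  rw [← integrableOn_univ, ← Iic_union_Ioi (a := (0 : ℝ))]
  refine IntegrableOn.union ?_ ?_
  · refine (integrableOn_exp_mul_Iic hs 0).congr_fun (fun x hx => ?_) measurableSet_Iic
    simp only [abs_of_nonpos (mem_Iic.1 hx)]
    ring_nf
  · refine (integrableOn_exp_mul_Ioi (neg_lt_zero.2 hs) 0).congr_fun (fun x hx => ?_)
      measurableSet_Ioi
    simp only [abs_of_pos (mem_Ioi.1 hx)]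
    ring_nf

theorem ExpDecay.mul {R : Type*} [NormedRing R] {f g : ℝ → R} (hf : ExpDecay f)
    (hg : ExpDecay g) : ExpDecay (fun x => f x * g x) := by
  obtain ⟨D, hD0, hD⟩ := hg.bounded
  obtain ⟨C, s, hs, h⟩ := hf
  refine ⟨C * D, s, hs, fun x => (norm_mul_le _ _).trans ?_⟩
  calc _ ≤ (C * Real.exp (-(s * |x|))) * D := by
        gcongr
        · exact (norm_nonneg _).trans (h x)
        · exact h x
        · exact hD x
    _ = _ := by ring

theorem ExpDecay.of_norm_le {F : Type*} [NormedAddCommGroup F] {f : ℝ → E} {g : ℝ → F}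
    (hf : ExpDecay f) (h : ∀ x, ‖g x‖ ≤ ‖f x‖) : ExpDecay g := by
  obtain ⟨C, s, hs, hC⟩ := hf
  exact ⟨C, s, hs, fun x => (h x).trans (hC x)⟩

theorem ExpDecay.of_half_lines {f : ℝ → E} {C D s : ℝ} (hs : 0 < s)
    (h1 : ∀ x, ‖f x‖ ≤ C * Real.exp (-(s * x))) (h2 : ∀ x, ‖f x‖ ≤ D * Real.exp (-(s * -x))) :
    ExpDecay f := by
  refine ⟨max C D, s, hs, fun x => ?_⟩
  rcases le_total 0 x with hx | hx
  · rw [abs_of_nonneg hx]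
    exact (h1 x).trans (by gcongr; exact le_max_left _ _)
  · rw [abs_of_nonpos hx]
    exact (h2 x).trans (by gcongr; exact le_max_right _ _)

/-- Green's identity on the whole line: the boundary terms vanish at both ends, leaving `(k² - l²) ∫
f g = 0`. -/
theorem integral_mul_eq_zero {f g : ℝ → ℂ} (hf : IsSchrodingerSolution u k f)
    (hg : IsSchrodingerSolution u l g) (hkl : k ^ 2 ≠ l ^ 2) (df : ExpDecay f)
    (df' : ExpDecay (deriv f)) (dg : ExpDecay g) (dg' : ExpDecay (deriv g)) :
    ∫ x, f x * g x = 0 := by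
  have hcf : Continuous f := hf.contDiff.continuous
  have hcg : Continuous g := hg.contDiff.continuous
  have ht := (df.tendsto_atTop.mul dg'.tendsto_atTop).sub (dg.tendsto_atTop.mul df'.tendsto_atTop)
  have hb := (df.tendsto_atBot.mul dg'.tendsto_atBot).sub (dg.tendsto_atBot.mul df'.tendsto_atBot)
  have h := integral_of_hasDerivAt_of_tendsto (hasDerivAt_wronskianFn hf hg)
    (((df.mul dg).integrable (hcf.mul hcg)).const_mul _) hb ht
  rw [sub_self, integral_const_mul] at h
  exact (mul_eq_zero.1 h).resolve_left (sub_ne_zero.2 hkl)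

end Decay

/-! ### Location and simplicity of the zeros -/

section Zeros

variable {u : ℝ → ℝ} {k : ℂ}

theorem exists_eq_const_mul (hc : Continuous u) (hi : Integrable u) (hk : 0 ≤ k.im) (hk0 : k ≠ 0)
    (hB : scatteringB u k = 0) : ∃ c : ℂ, c ≠ 0 ∧
      (∀ x, jostFun hi.comp_neg k (-x) = c * jostFun hi k x) ∧
      ∀ x, deriv (jostFun hi.comp_neg k) (-x) = -(c * deriv (jostFun hi k) x) := by
  have hψ := isRightJost_jostFun hc hi hk hk0
  have hφ := isLeftJost_jostPhi hc hi hk hk0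
  rw [jostPhi_eq hc hi hk hk0] at hφ
  have hW : wronskianFn (fun x => jostFun hi.comp_neg k (-x)) (jostFun hi k) 0 = 0 := by
    rw [scatteringB, jostPsi_eq hc hi hk hk0, jostPhi_eq hc hi hk hk0] at hB
    exact (div_eq_zero_iff.1 hB).resolve_right
      (mul_ne_zero (mul_ne_zero two_ne_zero Complex.I_ne_zero) hk0)
  obtain ⟨c, h⟩ := eq_const_mul_of_wronskian_eq_zero hc hφ.solution hψ.solution hW
    (rightJost_exists_ne_zero hψ)
  refine ⟨c, ?_, h, fun x => ?_⟩
  · rintro rfl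
    obtain ⟨x, hx⟩ := rightJost_exists_ne_zero
      (isRightJost_jostFun (u := fun x => u (-x)) (by fun_prop) hi.comp_neg hk hk0)
    have := h (-x)
    rw [neg_neg, zero_mul] at this
    exact hx this
  · have h1 := deriv_comp_neg (jostFun hi.comp_neg k) x
    have h2 : (fun x => jostFun hi.comp_neg k (-x)) = fun x => c * jostFun hi k x := funext h
    rw [h2, (isSchrodingerSolution_const_mul hc c hψ.solution).2] at h1
    linear_combination h1

/-- For real `k` the conjugate of `ψ_k` is the Jost solution for `-k`, so `coefficient_eq` with `a =
0`, `b = 1` computes this Wronskian. -/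
theorem wronskianFn_conj (hc : Continuous u) {f : ℝ → ℂ} (hk : k.im = 0) (hk0 : k ≠ 0)
    (hf : IsRightJost u k f) : starRingEnd ℂ (f 0) * deriv f 0 - f 0 * starRingEnd ℂ (deriv f 0) =
      2 * Complex.I * k := by
  have hg := isRightJost_conj hc hf
  rw [Complex.conj_eq_iff_im.2 hk] at hg
  have h := coefficient_eq (a := 0) (b := 1) hk0 hf hg
  rw [div_eq_one_iff_eq (mul_ne_zero (mul_ne_zero two_ne_zero Complex.I_ne_zero) hk0)] at h
  simp only [zero_mul, one_mul, zero_add, wronskianFn] at h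
  rwa [(isSchrodingerSolution_conj hc hf.solution).2] at h

/-- The flux identity holds for `u` and for its reflection. Proportionality with factor `c`
multiplies the flux by `|c|²`, and reflection reverses its sign, which yields `2ik (|c|² + 1) = 0`.
-/
theorem scatteringB_ne_zero_of_real (hc : Continuous u) (hi : Integrable u) (hk : k.im = 0)
    (hk0 : k ≠ 0) : scatteringB u k ≠ 0 := by
  intro hB
  obtain ⟨c, -, h, h'⟩ := exists_eq_const_mul hc hi hk.ge hk0 hB
  have h1 := wronskianFn_conj hc hk hk0 (isRightJost_jostFun hc hi hk.ge hk0)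
  have h2 := wronskianFn_conj (by fun_prop) hk hk0
    (isRightJost_jostFun (u := fun x => u (-x)) (by fun_prop) hi.comp_neg hk.ge hk0)
  have e := h 0
  have e' := h' 0
  rw [neg_zero] at e e'
  rw [e, e'] at h2
  simp only [map_mul, map_neg] at h2
  have h3 : (2 * Complex.I * k) * ((Complex.normSq c : ℂ) + 1) = 0 := by
    rw [Complex.normSq_eq_conj_mul_self]
    linear_combination -h2 - starRingEnd ℂ c * c * h1
  have h4 : (Complex.normSq c : ℂ) + 1 = 0 := (mul_eq_zero.1 h3).resolve_left
    (mul_ne_zero (mul_ne_zero two_ne_zero Complex.I_ne_zero) hk0)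
  have h5 : Complex.normSq c + 1 = 0 := by exact_mod_cast h4
  linarith [Complex.normSq_nonneg c]

/-- Decay at `+∞` is built into `ψ_k`; decay at `-∞` is inherited from `φ_k = c ψ_k`, after division
by `|c| > 0`. -/
theorem expDecay_jostFun (hc : Continuous u) (hi : Integrable u) (hk : 0 < k.im)
    (hB : scatteringB u k = 0) :
    ExpDecay (jostFun hi k) ∧ ExpDecay (deriv (jostFun hi k)) := by
  have hk0 := ne_zero_of_im_pos hk
  obtain ⟨c, hc0, h, h'⟩ := exists_eq_const_mul hc hi hk.le hk0 hB
  have hcn : 0 < ‖c‖ := norm_pos_iff.2 hc0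
  constructor
  · refine ExpDecay.of_half_lines hk (norm_jostFun_le hi k)
      (D := ‖jostM hi.comp_neg k‖ / ‖c‖) fun x => ?_
    have h1 := norm_jostFun_le hi.comp_neg k (-x)
    rw [h, norm_mul] at h1
    rw [div_mul_eq_mul_div, le_div_iff₀ hcn]
    linarith
  · have h0 := norm_deriv_jostFun_le (u := fun x => u (-x)) (by fun_prop) hi.comp_neg hk.le hk0
    refine ExpDecay.of_half_lines hk (norm_deriv_jostFun_le hc hi hk.le hk0)
      (D := (‖jostM hi.comp_neg k‖ * (∫ t, |u (-t)|) + ‖k‖ * ‖jostM hi.comp_neg k‖) / ‖c‖)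
      fun x => ?_
    have h1 := h0 (-x)
    rw [h', norm_neg, norm_mul] at h1
    rw [div_mul_eq_mul_div, le_div_iff₀ hcn]
    linarith

theorem integral_jostFun_mul_conj_ne_zero (hc : Continuous u) (hi : Integrable u) (hk : 0 < k.im)
    (hB : scatteringB u k = 0) :
    ∫ x, jostFun hi k x * starRingEnd ℂ (jostFun hi k x) ≠ 0 := by
  have hd := (expDecay_jostFun hc hi hk hB).1
  have hcf := continuous_jostFun hi k
  obtain ⟨x, hx⟩ := rightJost_exists_ne_zero
    (isRightJost_jostFun hc hi hk.le (ne_zero_of_im_pos hk))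
  have h : 0 < ∫ x, Complex.normSq (jostFun hi k x) := by
    refine integral_pos_of_integrable_nonneg_nonzero (x := x)
      (Complex.continuous_normSq.comp hcf) ?_ (fun x => Complex.normSq_nonneg _)
      (by simpa using hx)
    refine ((hd.mul hd).of_norm_le fun x => ?_).integrable (Complex.continuous_normSq.comp hcf)
    rw [norm_mul, Complex.normSq_eq_norm_sq, sq, norm_mul, norm_norm]
  simp only [Complex.mul_conj]
  rw [integral_complex_ofReal]
  exact_mod_cast h.ne'

/-- The conjugate of `ψ_k` solves the equation for `-k̄`. If `k²` were not real, orthogonality would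
force `∫ |ψ_k|² = 0`. -/
theorem re_eq_zero_of_zero (hc : Continuous u) (hi : Integrable u) (hk : 0 < k.im)
    (hB : scatteringB u k = 0) : k.re = 0 := by
  by_contra hre
  obtain ⟨d, d'⟩ := expDecay_jostFun hc hi hk hB
  have hs := (isSchrodingerSolution_jostFun hc hi hk.le (ne_zero_of_im_pos hk)).1
  obtain ⟨hs2, hd2⟩ := isSchrodingerSolution_conj hc hs
  refine integral_jostFun_mul_conj_ne_zero hc hi hk hB (integral_mul_eq_zero hs hs2 ?_ d d'
    (d.of_norm_le fun x => (RCLike.norm_conj _).le) ?_)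
  · rw [neg_sq]
    intro h
    have := congrArg Complex.im h
    simp [sq] at this
    exact (mul_ne_zero hre hk.ne') (by linarith)
  · rw [hd2]
    exact d'.of_norm_le fun x => (RCLike.norm_conj _).le

theorem conj_jostFun (hc : Continuous u) (hi : Integrable u) (hk : 0 < k.im) (hre : k.re = 0)
    (x : ℝ) : starRingEnd ℂ (jostFun hi k x) = jostFun hi k x := by
  have h := isRightJost_jostFun hc hi hk.le (ne_zero_of_im_pos hk)
  have h1 := isRightJost_conj hc h
  have e : -(starRingEnd ℂ k) = k := by apply Complex.ext <;> simp [hre]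
  rw [e] at h1
  exact congrFun (rightJost_unique hc hk.le h1 h) x

/-- Here `N` is the Wronskian `W(φ, ψ)` at `0`, written with reflected Jost functions. The half-line
identities for `u` and its reflection combine, through `φ_k = c ψ_k`, to `N'(k) = 2kc ∫ ψ_k²`. -/
theorem analyticOrderAt_scatteringB (hc : Continuous u) (hi : Integrable u) (hk : 0 < k.im)
    (hB : scatteringB u k = 0) : analyticOrderAt (scatteringB u) k = 1 := by
  have hc' : Continuous fun x => u (-x) := by fun_prop
  have hk0 := ne_zero_of_im_pos hk
  have h2 : ∀ {l : ℂ}, l ≠ 0 → 2 * Complex.I * l ≠ 0 := fun hl =>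
    mul_ne_zero (mul_ne_zero two_ne_zero Complex.I_ne_zero) hl
  set N : ℂ → ℂ := fun l => jostFun hi.comp_neg l 0 * deriv (jostFun hi l) 0 +
      jostFun hi l 0 * deriv (jostFun hi.comp_neg l) 0 with hN
  have hev : ∀ {l : ℂ}, 0 < l.im →
      scatteringB u =ᶠ[𝓝 l] fun l => N l / (2 * Complex.I * l) := by
    intro l hl
    filter_upwards [eventually_im_pos hl] with m hm
    exact scatteringB_eq hc hi hm.le (ne_zero_of_im_pos hm)
  have hdN : ∀ {l : ℂ}, 0 < l.im → HasDerivAt N _ l := fun {l} hl =>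
    ((differentiableAt_jostFun_zero hc' hi.comp_neg hl).hasDerivAt.mul
      (differentiableAt_deriv_jostFun_zero hc hi hl).hasDerivAt).add
    ((differentiableAt_jostFun_zero hc hi hl).hasDerivAt.mul
      (differentiableAt_deriv_jostFun_zero hc' hi.comp_neg hl).hasDerivAt)
  have hdB : ∀ {l : ℂ}, 0 < l.im → HasDerivAt (scatteringB u) _ l := fun {l} hl =>
    ((hdN hl).div ((hasDerivAt_id l).const_mul (2 * Complex.I))
      (h2 (ne_zero_of_im_pos hl))).congr_of_eventuallyEq (hev hl)
  have han : AnalyticAt ℂ (scatteringB u) k := by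
    refine DifferentiableOn.analyticAt (s := {l | 0 < l.im})
      (fun l hl => (hdB hl).differentiableAt.differentiableWithinAt) ?_
    exact eventually_im_pos hk
  refine han.analyticOrderAt_eq_one_of_zero_deriv_ne_zero hB ?_
  obtain ⟨c, hc0, h, h'⟩ := exists_eq_const_mul hc hi hk.le hk0 hB
  have hN0 : N k = 0 := by
    have := (hev hk).self_of_nhds
    rw [hB, eq_comm, div_eq_zero_iff] at this
    exact this.resolve_right (h2 hk0)
  have hre := re_eq_zero_of_zero hc hi hk hB
  have hI := jostFun_mul_deriv_sub hc hi hk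
  have hI' := jostFun_mul_deriv_sub hc' hi.comp_neg hk
  have hsplit : (∫ x in Ioi 0, jostFun hi.comp_neg k x * jostFun hi.comp_neg k x) =
      c ^ 2 * ∫ x in Iic 0, jostFun hi k x * jostFun hi k x := by
    have e := integral_comp_neg_Iic (0 : ℝ)
      (fun x => jostFun hi.comp_neg k x * jostFun hi.comp_neg k x)
    rw [neg_zero] at e
    rw [← e, ← integral_const_mul]
    simp only [h]
    exact integral_congr_ae (ae_of_all _ fun x => by ring)
  have hint : Integrable fun x => jostFun hi k x * jostFun hi k x :=
    ((expDecay_jostFun hc hi hk hB).1.mul (expDecay_jostFun hc hi hk hB).1).integrable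
      ((continuous_jostFun hi k).mul (continuous_jostFun hi k))
  have hsum := intervalIntegral.integral_Iic_add_Ioi (b := (0 : ℝ)) hint.integrableOn
    hint.integrableOn
  have hne := integral_jostFun_mul_conj_ne_zero hc hi hk hB
  simp only [conj_jostFun hc hi hk hre] at hne
  rw [hsplit] at hI'
  have e := h 0
  have e' := h' 0
  rw [neg_zero] at e e'
  rw [e, e'] at hI'
  rw [(hdB hk).deriv, hN0]
  simp only [id, e, e']
  set I := ∫ x, jostFun hi k x * jostFun hi k x
  set I1 := ∫ x in Ioi 0, jostFun hi k x * jostFun hi k x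
  set I2 := ∫ x in Iic 0, jostFun hi k x * jostFun hi k x
  -- The quotient rule for `N / (2ik)`, with `N k = 0`, leaves this expression with `w = N'(k)`.
  have key : ∀ w : ℂ, w = 2 * k * c * I → w * (2 * Complex.I * k) / (2 * Complex.I * k) ^ 2 ≠ 0 := by
    rintro w rfl
    exact div_ne_zero (mul_ne_zero (mul_ne_zero (mul_ne_zero (mul_ne_zero two_ne_zero hk0) hc0) hne)
      (h2 hk0)) (pow_ne_zero _ (h2 hk0))
  rw [zero_mul, sub_zero]
  apply key
  -- The reflected identity carries `c²` on its integral, so the sum is formed after multiplying by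
  -- `c`.
  apply mul_left_cancel₀ hc0
  rw [← hsum]
  linear_combination c ^ 2 * hI + hI'

end Zeros

/-! ### Finiteness through the quadratic form -/

section QuadraticForm

variable {u : ℝ → ℝ} {G G' : ℝ → ℝ}

/-- Cauchy–Schwarz, obtained from nonnegativity of `∫ (G' - r)²` where `r` is the mean of `G'`. -/
theorem sq_sub_le_mul_integral (hG : ∀ x, HasDerivAt G (G' x) x) (hc : Continuous G') {a c : ℝ}
    (hac : a < c) : (G c - G a) ^ 2 ≤ (c - a) * ∫ t in Ioc a c, G' t ^ 2 := by
  have hca : 0 < c - a := sub_pos.2 hac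
  set r := (G c - G a) / (c - a) with hr
  have hii : ∀ {F : ℝ → ℝ}, Continuous F → IntervalIntegrable F volume a c :=
    fun hF => hF.intervalIntegrable a c
  have h1 : ∫ t in a..c, G' t = G c - G a :=
    intervalIntegral.integral_eq_sub_of_hasDerivAt (fun x _ => hG x) (hii hc)
  have h2 : 0 ≤ ∫ t in a..c, (G' t - r) ^ 2 :=
    intervalIntegral.integral_nonneg hac.le fun t _ => sq_nonneg _
  have h3 : ∫ t in a..c, (G' t - r) ^ 2 =
      (∫ t in a..c, G' t ^ 2) - (2 * r * (G c - G a) - r ^ 2 * (c - a)) := by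
    rw [← h1, ← intervalIntegral.integral_const_mul]
    have e : r ^ 2 * (c - a) = ∫ _ in a..c, r ^ 2 := by
      rw [intervalIntegral.integral_const, smul_eq_mul, mul_comm]
    rw [e, ← intervalIntegral.integral_sub (hii (by fun_prop)) (hii (by fun_prop)),
      ← intervalIntegral.integral_sub (hii (by fun_prop)) (hii (by fun_prop))]
    exact intervalIntegral.integral_congr fun t _ => by ring
  rw [h3, intervalIntegral.integral_of_le hac.le] at h2
  have h4 : 2 * r * (G c - G a) - r ^ 2 * (c - a) = (G c - G a) ^ 2 / (c - a) := by
    rw [hr]; field_simp; ring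
  rw [h4, sub_nonneg, div_le_iff₀ hca] at h2
  linarith

/-- Since `G b = 0`, Cauchy–Schwarz gives `G(x)² ≤ |x - b| ∫_s G'²` on `s`; integrating against
`|u|` costs a factor at most `1`. The condition `hsub` allows `b` to be an endpoint outside `s`. -/
theorem setIntegral_abs_mul_sq_le (hu : Continuous u) (hG : ∀ x, HasDerivAt G (G' x) x)
    (hc : Continuous G') {s : Set ℝ} (hs : MeasurableSet s) {b : ℝ} (hb : G b = 0)
    (hsub : ∀ x ∈ s, Ioc b x ⊆ s ∧ Ioc x b ⊆ s ) (hI : IntegrableOn (fun x => G' x ^ 2) s)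
    (hw : IntegrableOn (fun x => |x - b| * |u x|) s) (hw1 : ∫ x in s, |x - b| * |u x| ≤ 1) :
    ∫ x in s, |u x| * G x ^ 2 ≤ ∫ x in s, G' x ^ 2 := by
  have hGc : Continuous G := continuous_iff_continuousAt.2 fun x => (hG x).continuousAt
  set D := ∫ x in s, G' x ^ 2 with hD
  have hD0 : 0 ≤ D := integral_nonneg fun x => sq_nonneg _
  have hle : ∀ {a c : ℝ}, Ioc a c ⊆ s → ∫ t in Ioc a c, G' t ^ 2 ≤ D := fun h =>
    setIntegral_mono_set hI (ae_of_all _ fun _ => sq_nonneg _) h.eventuallyLE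
  have hpt : ∀ x ∈ s, |u x| * G x ^ 2 ≤ |x - b| * |u x| * D := by
    intro x hx
    have h : G x ^ 2 ≤ |x - b| * D := by
      rcases lt_trichotomy b x with h | h | h
      · have h1 := sq_sub_le_mul_integral hG hc h
        rw [hb, sub_zero] at h1
        rw [abs_of_pos (sub_pos.2 h)]
        exact h1.trans (mul_le_mul_of_nonneg_left (hle (hsub x hx).1) (sub_pos.2 h).le)
      · simp [← h, hb]
      · have h1 := sq_sub_le_mul_integral hG hc h
        rw [hb, zero_sub, neg_sq] at h1
        rw [abs_sub_comm, abs_of_pos (sub_pos.2 h)]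
        exact h1.trans (mul_le_mul_of_nonneg_left (hle (hsub x hx).2) (sub_pos.2 h).le)
    calc _ ≤ |u x| * (|x - b| * D) := by gcongr
      _ = _ := by ring
  have hint : IntegrableOn (fun x => |u x| * G x ^ 2) s := by
    refine Integrable.mono' (hw.mul_const D) (by fun_prop)
      ((ae_restrict_iff' hs).2 (ae_of_all _ fun x hx => ?_))
    rw [Real.norm_of_nonneg (by positivity)]
    exact hpt x hx
  calc _ ≤ ∫ x in s, |x - b| * |u x| * D := setIntegral_mono_on hint (hw.mul_const D) hs hpt
    _ = (∫ x in s, |x - b| * |u x|) * D := integral_mul_const _ _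
    _ ≤ 1 * D := by gcongr
    _ = D := one_mul D

theorem integrable_of_faddeevClass (hu : FaddeevClass u) : Integrable u := by
  refine hu.integrable.mono' hu.contDiff.continuous.aestronglyMeasurable (ae_of_all _ fun x => ?_)
  rw [Real.norm_eq_abs]
  exact le_mul_of_one_le_left (abs_nonneg _) (by linarith [abs_nonneg x])

theorem integrable_abs_sub_mul (hu : FaddeevClass u) (b : ℝ) :
    Integrable fun x => |x - b| * |u x| := by
  have hc := hu.contDiff.continuous
  refine (hu.integrable.const_mul (1 + |b|)).mono' (by fun_prop) (ae_of_all _ fun x => ?_)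
  rw [Real.norm_of_nonneg (by positivity), ← mul_assoc]
  gcongr
  have := abs_sub x b
  nlinarith [abs_nonneg x, abs_nonneg b]

/-- Finitely many points such that `∫ |u| G² ≤ ∫ G'²` for functions vanishing there. -/
theorem exists_points_quadraticForm_nonneg (hu : FaddeevClass u) : ∃ (N : ℕ) (p : ℕ → ℝ),
    ∀ G G' : ℝ → ℝ, (∀ x, HasDerivAt G (G' x) x) → Continuous G' →
      Integrable (fun x => G' x ^ 2) → Integrable (fun x => |u x| * G x ^ 2) →
      (∀ i ≤ N, G (p i) = 0) → ∫ x, |u x| * G x ^ 2 ≤ ∫ x, G' x ^ 2 := by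
  have hc := hu.contDiff.continuous
  have hi := integrable_of_faddeevClass hu
  have hw := integrable_abs_sub_mul hu
  have hw0 : Integrable fun x => |x| * |u x| := by simpa using hw 0
  obtain ⟨R, hR0, hR1, hR2⟩ : ∃ R : ℝ, 0 ≤ R ∧ (∫ x in Ioi R, |x| * |u x|) ≤ 1 ∧
      (∫ x in Iic (-R), |x| * |u x|) ≤ 1 := by
    have h1 : Tendsto (fun R : ℝ => ∫ x in Ioi R, |x| * |u x|) atTop (𝓝 0) :=
      tendsto_integral_Ioi_zero tendsto_id
    have h2 : Tendsto (fun R : ℝ => ∫ x in Iic (-R), |x| * |u x|) atTop (𝓝 0) :=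
      tendsto_integral_Iic_zero tendsto_neg_atTop_atBot
    obtain ⟨R, h⟩ := ((eventually_ge_atTop 0).and ((h1.eventually_le_const one_pos).and
      (h2.eventually_le_const one_pos))).exists
    exact ⟨R, h⟩
  -- With step `h = 2R / N` this gives `h ∫ |u| ≤ 1`, so each middle interval, based at its left
  -- endpoint, meets the weight condition.
  obtain ⟨N, hN⟩ := exists_nat_gt (2 * R * ∫ x, |u x|)
  have hNpos : (0 : ℝ) < N := lt_of_le_of_lt
    (mul_nonneg (by positivity) (integral_nonneg fun _ => abs_nonneg _)) hN
  set h : ℝ := 2 * R / N with hh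
  have hh0 : 0 ≤ h := by positivity
  -- There are `N + 1` points, from `-R` to `R`; the two extreme ones also serve the unbounded
  -- pieces.
  refine ⟨N, fun i => -R + i * h, fun G G' hG hG' hI1 hI2 hz => ?_⟩
  set F : ℝ → ℝ := fun x => |u x| * G x ^ 2 - G' x ^ 2 with hF
  have hFi : Integrable F := hI2.sub hI1
  have hpiece : ∀ {s : Set ℝ} {b : ℝ}, MeasurableSet s → G b = 0 →
      (∀ x ∈ s, Ioc b x ⊆ s ∧ Ioc x b ⊆ s ) → ∫ x in s, |x - b| * |u x| ≤ 1 →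
      ∫ x in s, F x ≤ 0 := by
    intro s b hs hb hsub hle
    rw [hF, integral_sub hI2.integrableOn hI1.integrableOn, sub_nonpos]
    exact setIntegral_abs_mul_sq_le hc hG hG' hs hb hsub hI1.integrableOn (hw b).integrableOn hle
  have hleft : ∫ x in Iic (-R), F x ≤ 0 := by
    refine hpiece measurableSet_Iic (b := -R) (by simpa using hz 0 (Nat.zero_le _)) ?_ ?_
    · intro x hx
      exact ⟨fun t ht => ht.2.trans hx, fun t ht => ht.2⟩
    · refine (setIntegral_mono_on (hw _).integrableOn hw0.integrableOn measurableSet_Iic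
        fun x hx => ?_).trans hR2
      rw [mem_Iic] at hx
      rw [abs_of_nonpos (by linarith : x - -R ≤ 0), abs_of_nonpos (by linarith : x ≤ 0)]
      gcongr
      linarith
  have hNh : -R + (N : ℝ) * h = R := by rw [hh]; field_simp; ring
  have hright : ∫ x in Ioi R, F x ≤ 0 := by
    refine hpiece measurableSet_Ioi (b := R) (by simpa [hNh] using hz N le_rfl) ?_ ?_
    · intro x hx
      exact ⟨fun t ht => ht.1, fun t ht => (mem_Ioi.1 hx).trans ht.1⟩
    · refine (setIntegral_mono_on (hw _).integrableOn hw0.integrableOn measurableSet_Ioi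
        fun x hx => ?_).trans hR1
      rw [mem_Ioi] at hx
      rw [abs_of_nonneg (by linarith : 0 ≤ x - R), abs_of_nonneg (by linarith : 0 ≤ x)]
      gcongr
      linarith
  have hmid : ∀ i < N, ∫ x in (-R + (i : ℕ) * h)..(-R + (i + 1 : ℕ) * h), F x ≤ 0 := by
    intro i hiN
    have hle : -R + (i : ℕ) * h ≤ -R + (i + 1 : ℕ) * h := by push_cast; linarith
    rw [intervalIntegral.integral_of_le hle]
    refine hpiece measurableSet_Ioc (hz i hiN.le) ?_ ?_
    · intro x hx
      exact ⟨fun t ht => ⟨ht.1, ht.2.trans hx.2⟩, fun t ht => ⟨hx.1.trans ht.1, ht.2.trans hle⟩⟩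
    · have h1 : ∫ x in Ioc (-R + (i : ℕ) * h) (-R + (i + 1 : ℕ) * h),
          |x - (-R + (i : ℕ) * h)| * |u x| ≤
          ∫ x in Ioc (-R + (i : ℕ) * h) (-R + (i + 1 : ℕ) * h), h * |u x| := by
        refine setIntegral_mono_on (hw _).integrableOn (hi.abs.const_mul h).integrableOn
          measurableSet_Ioc fun x hx => ?_
        have := hx.1
        have := hx.2
        push_cast at this
        rw [abs_of_nonneg (by linarith)]
        gcongr
        linarith
      refine h1.trans ((setIntegral_le_integral (hi.abs.const_mul h)
        (ae_of_all _ fun x => by positivity)).trans ?_)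
      rw [integral_const_mul, hh, div_mul_eq_mul_div, div_le_one hNpos]
      exact hN.le
  have hsum := intervalIntegral.sum_integral_adjacent_intervals (f := F) (μ := volume)
    (a := fun i : ℕ => -R + i * h) (n := N) (fun i _ => hFi.intervalIntegrable)
  have hmid' : ∫ x in (-R)..R, F x ≤ 0 := by
    have e0 : -R + ((0 : ℕ) : ℝ) * h = -R := by simp
    rw [e0, hNh] at hsum
    rw [← hsum]
    exact Finset.sum_nonpos fun i hi => hmid i (Finset.mem_range.1 hi)
  have e1 := intervalIntegral.integral_Iic_add_Ioi (b := R) hFi.integrableOn hFi.integrableOn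
  have e2 := intervalIntegral.integral_Iic_sub_Iic (a := -R) (b := R) hFi.integrableOn
    hFi.integrableOn
  have e3 : ∫ x, F x = (∫ x, |u x| * G x ^ 2) - ∫ x, G' x ^ 2 := integral_sub hI2 hI1
  linarith

/-- Real eigenfunctions of `-d²/dx² - u` with distinct energies `-σ²`, decaying exponentially. -/
structure EigenSystem (u : ℝ → ℝ) {ι : Type*} (σ : ι → ℝ) (g g' : ι → ℝ → ℝ) : Prop where
  pos : ∀ i, 0 < σ i
  hasDerivAt : ∀ i x, HasDerivAt (g i) (g' i x) x
  hasDerivAt' : ∀ i x, HasDerivAt (g' i) ((σ i ^ 2 - u x) * g i x) x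
  decay : ∀ i, ExpDecay (g i)
  decay' : ∀ i, ExpDecay (g' i)
  orthogonal : ∀ i j, i ≠ j → ∫ x, g i x * g j x = 0
  ne_zero : ∀ i, ∃ x, g i x ≠ 0

theorem ExpDecay.const_mul {f : ℝ → ℝ} (c : ℝ) (hf : ExpDecay f) :
    ExpDecay fun x => c * f x := by
  obtain ⟨C, s, hs, h⟩ := hf
  refine ⟨|c| * C, s, hs, fun x => ?_⟩
  rw [norm_mul, Real.norm_eq_abs, mul_assoc]
  exact mul_le_mul_of_nonneg_left (h x) (abs_nonneg c)

theorem ExpDecay.add {f g : ℝ → ℝ} (hf : ExpDecay f) (hg : ExpDecay g) :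
    ExpDecay fun x => f x + g x := by
  obtain ⟨C, s, hs, h⟩ := hf
  obtain ⟨D, t, ht, h'⟩ := hg
  have hC : 0 ≤ C := by simpa using (norm_nonneg _).trans (h 0)
  have hD : 0 ≤ D := by simpa using (norm_nonneg _).trans (h' 0)
  refine ⟨C + D, min s t, lt_min hs ht, fun x => (norm_add_le _ _).trans ?_⟩
  rw [add_mul]
  refine add_le_add ((h x).trans ?_) ((h' x).trans ?_)
  · gcongr
    exact min_le_left _ _
  · gcongr
    exact min_le_right _ _

theorem expDecay_sum_const_mul {ι : Type*} [Fintype ι] (c : ι → ℝ) {f : ι → ℝ → ℝ}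
    (hf : ∀ i, ExpDecay (f i)) : ExpDecay fun x => ∑ i, c i * f i x := by
  classical
  refine Finset.induction_on (motive := fun s => ExpDecay fun x => ∑ i ∈ s, c i * f i x)
    Finset.univ ⟨0, 1, one_pos, by simp⟩ fun i s his ih => ?_
  simp only [Finset.sum_insert his]
  exact ((hf i).const_mul (c i)).add ih

/-- Integrating `(G G')' = G'² + G H - u G²`, with `H = ∑ c_i σ_i² g_i`, gives `∫ u G² = ∫ G'² + ∫ G
H`. By orthogonality `∫ G H = ∑ c_i² σ_i² ∫ g_i²`, which is positive for `c ≠ 0`; finally `u ≤ |u|`.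
-/
theorem EigenSystem.quadraticForm {ι : Type*} [Fintype ι] {σ : ι → ℝ} {g g' : ι → ℝ → ℝ}
    (hi : Integrable u) (h : EigenSystem u σ g g') (c : ι → ℝ) (hc0 : c ≠ 0) :
    (∀ x, HasDerivAt (fun x => ∑ i, c i * g i x) (∑ i, c i * g' i x) x) ∧
    Continuous (fun x => ∑ i, c i * g' i x) ∧
    Integrable (fun x => (∑ i, c i * g' i x) ^ 2) ∧
    Integrable (fun x => |u x| * (∑ i, c i * g i x) ^ 2) ∧
    ∫ x, (∑ i, c i * g' i x) ^ 2 < ∫ x, |u x| * (∑ i, c i * g i x) ^ 2 := by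
  have hcg : ∀ i, Continuous (g i) := fun i =>
    continuous_iff_continuousAt.2 fun x => (h.hasDerivAt i x).continuousAt
  have hcg' : ∀ i, Continuous (g' i) := fun i =>
    continuous_iff_continuousAt.2 fun x => (h.hasDerivAt' i x).continuousAt
  set G : ℝ → ℝ := fun x => ∑ i, c i * g i x with hG
  set G' : ℝ → ℝ := fun x => ∑ i, c i * g' i x with hG'
  set H : ℝ → ℝ := fun x => ∑ i, c i * σ i ^ 2 * g i x with hH
  have hcG : Continuous G := by fun_prop
  have hcG' : Continuous G' := by fun_prop
  have hcH : Continuous H := by fun_prop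
  have dG : ExpDecay G := expDecay_sum_const_mul c h.decay
  have dG' : ExpDecay G' := expDecay_sum_const_mul c h.decay'
  have dH : ExpDecay H := expDecay_sum_const_mul _ h.decay
  have h1 : ∀ x, HasDerivAt G (G' x) x := fun x =>
    HasDerivAt.fun_sum fun i _ => (h.hasDerivAt i x).const_mul (c i)
  have h2 : ∀ x, HasDerivAt G' (H x - u x * G x) x := fun x => by
    refine (HasDerivAt.fun_sum fun i _ => (h.hasDerivAt' i x).const_mul (c i)).congr_deriv ?_
    rw [hG, hH, Finset.mul_sum, ← Finset.sum_sub_distrib]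
    exact Finset.sum_congr rfl fun i _ => by ring
  obtain ⟨C, hC0, hC⟩ := (dG.mul dG).bounded
  have hIu : ∀ {v : ℝ → ℝ}, Integrable v → Integrable fun x => v x * G x ^ 2 := fun hv =>
    hv.mul_bdd (c := C) (by fun_prop) (ae_of_all _ fun x => by simpa only [sq] using hC x)
  have hIG' : Integrable fun x => G' x ^ 2 := by
    simpa only [sq] using (dG'.mul dG').integrable (hcG'.mul hcG')
  have hIGH : Integrable fun x => G x * H x := (dG.mul dH).integrable (hcG.mul hcH)
  have hIs : Integrable fun x => G' x ^ 2 + G x * H x := hIG'.add hIGH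
  have hzero := integral_of_hasDerivAt_of_tendsto
    (f := fun x => G x * G' x) (f' := fun x => G' x ^ 2 + G x * H x - u x * G x ^ 2)
    (fun x => ((h1 x).mul (h2 x)).congr_deriv (by ring)) (hIs.sub (hIu hi))
    (dG.mul dG').tendsto_atBot (dG.mul dG').tendsto_atTop
  rw [integral_sub hIs (hIu hi), integral_add hIG' hIGH] at hzero
  have hGH : 0 < ∫ x, G x * H x := by
    have hij : ∀ i j, Integrable fun x => c i * (c j * σ j ^ 2) * (g i x * g j x) := fun i j =>
      (((h.decay i).mul (h.decay j)).integrable ((hcg i).mul (hcg j))).const_mul _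
    have e : ∀ x, G x * H x = ∑ i, ∑ j, c i * (c j * σ j ^ 2) * (g i x * g j x) := fun x => by
      rw [hG, hH, Finset.sum_mul_sum]
      exact Finset.sum_congr rfl fun i _ => Finset.sum_congr rfl fun j _ => by ring
    simp_rw [e]
    rw [integral_finsetSum _ fun i _ => integrable_finsetSum _ fun j _ => hij i j]
    have e2 : ∀ i, ∫ x, ∑ j, c i * (c j * σ j ^ 2) * (g i x * g j x) =
        c i ^ 2 * σ i ^ 2 * ∫ x, g i x * g i x := fun i => by
      rw [integral_finsetSum _ fun j _ => hij i j, Finset.sum_eq_single i]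
      · rw [integral_const_mul]; ring
      · intro j _ hj
        rw [integral_const_mul, h.orthogonal i j hj.symm, mul_zero]
      · simp
    simp_rw [e2]
    have hpos : ∀ i, 0 < ∫ x, g i x * g i x := fun i => by
      obtain ⟨x, hx⟩ := h.ne_zero i
      exact integral_pos_of_integrable_nonneg_nonzero (x := x) ((hcg i).mul (hcg i))
        (((h.decay i).mul (h.decay i)).integrable ((hcg i).mul (hcg i)))
        (fun x => mul_self_nonneg _) (mul_self_ne_zero.2 hx)
    obtain ⟨i, hi0⟩ := Function.ne_iff.1 hc0
    refine Finset.sum_pos' (fun j _ => mul_nonneg (by positivity) (hpos j).le)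
      ⟨i, Finset.mem_univ i, ?_⟩
    have := h.pos i
    have := hpos i
    have : c i ≠ 0 := hi0
    positivity
  have hle : ∫ x, u x * G x ^ 2 ≤ ∫ x, |u x| * G x ^ 2 :=
    integral_mono (hIu hi) (hIu hi.abs) fun x =>
      mul_le_mul_of_nonneg_right (le_abs_self _) (sq_nonneg _)
  exact ⟨h1, hcG', hIG', hIu hi.abs, by linarith⟩

/-- More than `N + 1` eigenfunctions would make evaluation at the `N + 1` points non-injective on
coefficients; a nonzero kernel vector contradicts the strict inequality of
`EigenSystem.quadraticForm`. -/
theorem EigenSystem.card_le {ι : Type*} [Fintype ι] {σ : ι → ℝ} {g g' : ι → ℝ → ℝ}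
    (hi : Integrable u) (h : EigenSystem u σ g g') {N : ℕ} {p : ℕ → ℝ}
    (hp : ∀ G G' : ℝ → ℝ, (∀ x, HasDerivAt G (G' x) x) → Continuous G' →
      Integrable (fun x => G' x ^ 2) → Integrable (fun x => |u x| * G x ^ 2) →
      (∀ i ≤ N, G (p i) = 0) → ∫ x, |u x| * G x ^ 2 ≤ ∫ x, G' x ^ 2) :
    Fintype.card ι ≤ N + 1 := by
  by_contra! hcard
  let L : (ι → ℝ) →ₗ[ℝ] (Fin (N + 1) → ℝ) :=
    Matrix.mulVecLin (Matrix.of fun (i : Fin (N + 1)) (j : ι) => g j (p i))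
  have hker : LinearMap.ker L ≠ ⊥ := LinearMap.ker_ne_bot_of_finrank_lt (by simpa using hcard)
  obtain ⟨c, hcL, hc0⟩ := Submodule.exists_mem_ne_zero_of_ne_bot hker
  obtain ⟨h1, h2, h3, h4, h5⟩ := h.quadraticForm hi c hc0
  refine absurd (hp _ _ h1 h2 h3 h4 fun i hiN => ?_) (not_le.2 h5)
  have := congrFun (LinearMap.mem_ker.1 hcL) ⟨i, Nat.lt_succ_of_le hiN⟩
  simp only [L, Matrix.mulVecLin_apply, Matrix.mulVec, dotProduct, Matrix.of_apply,
    Pi.zero_apply] at this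
  rw [← this]
  exact Finset.sum_congr rfl fun j _ => mul_comm _ _

/-- The zeros lie on the imaginary axis, where `k² = -(Im k)²` and `ψ_k` is real, so taking real
parts loses nothing. Distinct zeros there have distinct energies because `Im k > 0`. -/
theorem eigenSystem_jostFun (hc : Continuous u) (hi : Integrable u) {ι : Type*} (k : ι → ℂ)
    (hinj : Function.Injective k) (hk : ∀ i, 0 < (k i).im) (hB : ∀ i, scatteringB u (k i) = 0) :
    EigenSystem u (fun i => (k i).im) (fun i x => (jostFun hi (k i) x).re)
      (fun i x => (deriv (jostFun hi (k i)) x).re) := by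
  have hs := fun i => (isSchrodingerSolution_jostFun hc hi (hk i).le (ne_zero_of_im_pos (hk i))).1
  have hre := fun i => re_eq_zero_of_zero hc hi (hk i) (hB i)
  have hreal : ∀ i x, ((jostFun hi (k i) x).re : ℂ) = jostFun hi (k i) x := fun i x =>
    Complex.conj_eq_iff_re.1 (conj_jostFun hc hi (hk i) (hre i) x)
  have hsq : ∀ i, k i ^ 2 = ((-(k i).im ^ 2 : ℝ) : ℂ) := fun i => by
    apply Complex.ext <;> simp [sq, hre i]
  have hd : ∀ {f : ℝ → ℂ} {f' : ℂ} {x : ℝ}, HasDerivAt f f' x →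
      HasDerivAt (fun x => (f x).re) f'.re x := fun {f f' x} hf =>
    Complex.reCLM.hasFDerivAt.comp_hasDerivAt x hf
  refine ⟨hk, fun i x => hd (hasDerivAt_solution (hs i) x), fun i x => ?_, fun i => ?_, fun i => ?_,
    fun i j hij => ?_, fun i => ?_⟩
  · refine (hd (hasDerivAt_deriv_solution (hs i) x)).congr_deriv ?_
    rw [hsq, ← hreal i x]
    norm_cast
    ring
  · exact (expDecay_jostFun hc hi (hk i) (hB i)).1.of_norm_le fun x => Complex.abs_re_le_norm _
  · exact (expDecay_jostFun hc hi (hk i) (hB i)).2.of_norm_le fun x => Complex.abs_re_le_norm _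
  · obtain ⟨d1, d1'⟩ := expDecay_jostFun hc hi (hk i) (hB i)
    obtain ⟨d2, d2'⟩ := expDecay_jostFun hc hi (hk j) (hB j)
    have h := integral_mul_eq_zero (hs i) (hs j) (fun h => hij (hinj ?_)) d1 d1' d2 d2'
    · have e : ∀ x, jostFun hi (k i) x * jostFun hi (k j) x =
          (((jostFun hi (k i) x).re * (jostFun hi (k j) x).re : ℝ) : ℂ) := fun x => by
        rw [Complex.ofReal_mul, hreal, hreal]
      rw [integral_congr_ae (ae_of_all _ e), integral_complex_ofReal] at h
      exact_mod_cast h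
    · rw [hsq, hsq, Complex.ofReal_inj, neg_inj] at h
      exact Complex.ext ((hre i).trans (hre j).symm)
        ((sq_eq_sq₀ (hk i).le (hk j).le).1 h)
  · obtain ⟨x, hx⟩ := rightJost_exists_ne_zero
      (isRightJost_jostFun hc hi (hk i).le (ne_zero_of_im_pos (hk i)))
    refine ⟨x, fun h => hx ?_⟩
    rw [← hreal i x, h, Complex.ofReal_zero]

theorem finite_zeros (hu : FaddeevClass u) :
    {k : ℂ | 0 < k.im ∧ scatteringB u k = 0}.Finite := by
  have hc := hu.contDiff.continuous
  have hi := integrable_of_faddeevClass hu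
  obtain ⟨N, p, hp⟩ := exists_points_quadraticForm_nonneg hu
  by_contra hinf
  obtain ⟨t, ht, hcard⟩ := Set.Infinite.exists_subset_card_eq hinf (N + 2)
  have h := (eigenSystem_jostFun hc hi (fun i : t => (i : ℂ)) Subtype.val_injective
    (fun i => (ht i.2).1) (fun i => (ht i.2).2)).card_le hi hp
  rw [Fintype.card_coe, hcard] at h
  omega

end QuadraticForm

end

end Schrodinger

/-! ### Conclusion -/

theorem mainTheorem11 (u : ℝ → ℝ) (hu : FaddeevClass u) :
    {k : ℂ | 0 ≤ k.im ∧ k ≠ 0 ∧ scatteringB u k = 0}.Finite ∧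
      ∀ k : ℂ, 0 ≤ k.im → k ≠ 0 → scatteringB u k = 0 →
        k.re = 0 ∧ 0 < k.im ∧ analyticOrderAt (scatteringB u) k = 1 := by
  have hc := hu.contDiff.continuous
  have hi := Schrodinger.integrable_of_faddeevClass hu
  have him : ∀ k : ℂ, 0 ≤ k.im → k ≠ 0 → scatteringB u k = 0 → 0 < k.im :=
    fun k hk hk0 hB => lt_of_le_of_ne hk fun h =>
      Schrodinger.scatteringB_ne_zero_of_real hc hi h.symm hk0 hB
  refine ⟨(Schrodinger.finite_zeros hu).subset fun k hk => ⟨him k hk.1 hk.2.1 hk.2.2, hk.2.2⟩,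
    fun k hk hk0 hB => ?_⟩
  have hpos := him k hk hk0 hB
  exact ⟨Schrodinger.re_eq_zero_of_zero hc hi hpos hB, hpos,
    Schrodinger.analyticOrderAt_scatteringB hc hi hpos hB⟩
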